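/- **Setting.** Fix $m\in\mathbb N$. There are two groups of $m$ clients, $\mathcal C_{j,1},\dots,\mathcal C_{j,m}$ for $j\in\{0,1\}$, and a third party TEE without input. Client $\mathcal C_{j,i}$ holds a finite set $S_{j,i}\subseteq\{0,1\}^{u}$, and sets of different clients of the same group are disjoint. Here $u=u(\lambda)$ is bounded by a polynomial in the security parameter $\lambda$. The Group PSI functionality gives $\mathcal C_{j,i}$ the vector $\vec v_{j,i}=(S_{j,i}\cap S_{1-j,1},\dots,S_{j,i}\cap S_{1-j,m})$ and gives the TEE nothing. The leakage $\mathcal L(S)$ consists of all the numbers $|S_{j,i}\cap S_{1-j,l}|$ with $j\in\{0,1\}$ and $1\le i,l\le m$. **PRP.** $\mathrm{PRP}:\{0,1\}^{\lambda}\times\{0,1\}^{u(\lambda)}\to\{0,1\}^{u(\lambda)}$ is a secure pseudorandom permutation: each $\mathrm{PRP}(k,\cdot)$ is a permutation, PRP is computable in polynomial time, and no probabilistic polynomial-time (PPT) oracle adversary with polynomial-size advice distinguishes $\mathrm{PRP}(k,\cdot)$, for uniform $k$, from a uniform permutation of $\{0,1\}^{u}$ with non-negligible advantage. **Protocol EG-PSI$^{(\mathrm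 I)}$.** (1) Each $\mathcal C_{0,i}$ picks for each $l$ a uniform key $k_{i,l}\in\{0,1\}^\lambda$ and sends it to $\mathcal C_{1,l}$. (2) Each client encrypts all elements of its set with PRP under each of its $m$ keys, sends the set $S'_{j,i}$ of all resulting ciphertexts to the TEE, and keeps the triples (ciphertext, key, index of the client with whom the key is shared). (3) The TEE sends to $\mathcal C_{j,i}$ the set $R_{j,i}$ of those elements of $S'_{j,i}$ that occur more than once in the collection of all the sets $S'_{j',i'}$. (4) $\mathcal C_{j,i}$ looks up each element of $R_{j,i}$ in its triples, decrypts it with the key found, and puts the result into the component of its output vector that is given by the index found. The view of $\mathcal C_{j,i}$ consists of its set, its random coins (for $j=0$, the keys it picks), the keys it receives (for $j=1$), $R_{j,i}$ and its output. The view of the TEE consists of all the sets $S'_{j,i}$. A set is transmitted as the increasing list of its elements. **Theorem.** Assume that PRP is a secure pseudorandom permutation and that $2^{-u(\lambda)}$ is negligible in $\lambda$. Then EG-PSI$^{(\mathrm I)}$ securely realizes the Group PSI functionality with leakage $\mathcal L$ against static semi-honest adversaries corrupting one party. That is, for all families of inputs $S=(S_{j,i})$ as above whose set sizes are bounded by a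 polynomial in $\lambda$: * for every client $\mathcal C_{j,i}$ there is a PPT simulator, not depending on $S$, whose output on $(1^\lambda,1^u,S_{j,i},\vec v_{j,i})$ is computationally indistinguishable from the view of $\mathcal C_{j,i}$ in the protocol; * there is a PPT simulator, not depending on $S$, whose output on $(1^\lambda,1^u,\mathcal L(S))$ and the set sizes $(|S_{j,i}|)_{j,i}$, which are regarded as public, is computationally indistinguishable from the view of the TEE in the protocol. Distinguishers are PPT algorithms with polynomial-size advice. -/

import Mathlib

/-! # Group private set intersection: computational model, security notion, protocol -/

namespace GPSI

/-! ## Data and programs -/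

/-- The values that programs compute with: binary trees. -/
inductive Data : Type
  | nil : Data
  | node (a b : Data) : Data

namespace Data

/-- The number of nodes and leaves of a tree. -/
def size : Data → ℕ
  | nil => 1
  | node a b => a.size + b.size + 1

/-- The first component of a pair (`nil` for a value that is not a pair). -/
def fst : Data → Data
  | nil => nil
  | node a _ => a

/-- The second component of a pair (`nil` for a value that is not a pair). -/
def snd : Data → Data
  | nil => nil
  | node _ b => b

/-- The list `[x₁, …, xₖ]` as the tree `(x₁, (x₂, … (xₖ, nil)))`. -/
def ofList : List Data → Data
  | [] => nil
  | x :: xs => node x (ofList xs)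

/-- Every tree read as a list; inverse to `ofList`. -/
def toList : Data → List Data
  | nil => []
  | node x xs => x :: xs.toList

/-- A bit: `0` is `nil` and `1` is `(nil, nil)`. -/
def ofBool : Bool → Data
  | false => nil
  | true => node nil nil

/-- A number in unary. -/
def ofNat (n : ℕ) : Data := ofList (List.replicate n nil)

/-- A bit string, as the list of its bits, most significant bit first. -/
def ofBits {n : ℕ} (x : BitVec n) : Data :=
  ofList (List.ofFn fun i : Fin n => ofBool (x.getMsbD i))

/-- A vector of values. -/
def ofVec {m : ℕ} (v : Fin m → Data) : Data := ofList (List.ofFn v)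

/-- A finite set of bit strings, as the list of its elements in increasing order. -/
def ofFinset {n : ℕ} (s : Finset (BitVec n)) : Data :=
  ofList ((s.sort (· ≤ ·)).map ofBits)

theorem toList_ofList (l : List Data) : (ofList l).toList = l := by
  induction l with
  | nil => rfl
  | cons x xs ih => simp [ofList, toList, ih]

theorem ofList_injective : Function.Injective ofList :=
  Function.LeftInverse.injective toList_ofList

theorem ofBool_injective : Function.Injective ofBool := by
  intro a b h
  cases a <;> cases b <;> simp_all [ofBool]

/-- Distinct bit strings have distinct encodings. -/
theorem ofBits_injective (n : ℕ) : Function.Injective (ofBits (n := n)) := by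
  intro x y h
  have h1 := List.ofFn_injective (ofList_injective h)
  apply BitVec.eq_of_getMsbD_eq
  intro i hi
  exact ofBool_injective (congrFun h1 ⟨i, hi⟩)

end Data

/-- Probabilistic oracle programs. A program is evaluated in an environment, a list of values.

Iteration (`fold`) runs over a list that has been computed before. Since all algorithms below have
a polynomial time bound, this is no restriction: a machine with such a bound is simulated by
iterating its step function over a list that has been made long enough. -/
inductive Prog : Type
  /-- the value of the `i`-th variable of the environment (`nil` if there is none) -/
  | var (i : ℕ) : Prog
  /-- the constant `nil` -/
  | nil : Prog
  /-- the pair of two values -/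
  | pair (p q : Prog) : Prog
  /-- the first component -/
  | fst (p : Prog) : Prog
  /-- the second component -/
  | snd (p : Prog) : Prog
  /-- `cond p q r`: `q` if the value of `p` is not `nil`, otherwise `r` -/
  | cond (p q r : Prog) : Prog
  /-- `letIn p q`: evaluate `q` with the value of `p` added in front of the environment -/
  | letIn (p q : Prog) : Prog
  /-- `call q p`: evaluate `q` in the environment whose only entry is the value of `p` -/
  | call (q p : Prog) : Prog
  /-- `fold p q r`: start with the value of `q`, and for each entry `x` of the list `p` replace the
  current value `a` by the value of `r` in the environment extended by `x` and `a` -/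
  | fold (p q r : Prog) : Prog
  /-- a uniformly random bit -/
  | coin : Prog
  /-- the oracle's answer to the value of `p` -/
  | query (p : Prog) : Prog

/-- The program never queries its oracle. -/
def Prog.OracleFree : Prog → Prop
  | .var _ => True
  | .nil => True
  | .pair p q => p.OracleFree ∧ q.OracleFree
  | .fst p => p.OracleFree
  | .snd p => p.OracleFree
  | .cond p q r => p.OracleFree ∧ q.OracleFree ∧ r.OracleFree
  | .letIn p q => p.OracleFree ∧ q.OracleFree
  | .call q p => q.OracleFree ∧ p.OracleFree
  | .fold p q r => p.OracleFree ∧ q.OracleFree ∧ r.OracleFree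
  | .coin => True
  | .query _ => False

/-- An operation returns the value `d`: beyond the time `c` spent on its arguments it is charged
one step plus the size of its result. -/
noncomputable def emit (c : ℕ) (d : Data) : PMF (Data × ℕ) := PMF.pure (d, c + 1 + d.size)

/-- Iterate `f` over a list, starting with the value `a` and the time `c`, and add up the times. -/
noncomputable def foldTime (f : Data → Data → PMF (Data × ℕ)) :
    List Data → Data → ℕ → PMF (Data × ℕ)
  | [], a, c => PMF.pure (a, c)
  | x :: xs, a, c => (f x a).bind fun y => foldTime f xs y.1 (c + y.2)

/-- Evaluation with the oracle `O`: the joint distribution of the value and of the running time. -/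
noncomputable def Prog.eval (O : Data → Data) : Prog → List Data → PMF (Data × ℕ)
  | .var i, env => emit 0 (env.getD i Data.nil)
  | .nil, _ => emit 0 Data.nil
  | .pair p q, env =>
      (p.eval O env).bind fun a => (q.eval O env).bind fun b => emit (a.2 + b.2) (Data.node a.1 b.1)
  | .fst p, env => (p.eval O env).bind fun a => emit a.2 a.1.fst
  | .snd p, env => (p.eval O env).bind fun a => emit a.2 a.1.snd
  | .cond p q r, env =>
      (p.eval O env).bind fun a =>
        match a.1 with
        | Data.nil => (r.eval O env).bind fun b => emit (a.2 + b.2) b.1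
        | Data.node _ _ => (q.eval O env).bind fun b => emit (a.2 + b.2) b.1
  | .letIn p q, env =>
      (p.eval O env).bind fun a => (q.eval O (a.1 :: env)).bind fun b => emit (a.2 + b.2) b.1
  | .call q p, env =>
      (p.eval O env).bind fun a => (q.eval O [a.1]).bind fun b => emit (a.2 + b.2) b.1
  | .fold p q r, env =>
      (p.eval O env).bind fun l => (q.eval O env).bind fun a =>
        (foldTime (fun x y => r.eval O (x :: y :: env)) l.1.toList a.1 (l.2 + a.2)).bind fun b =>
          emit b.2 b.1
  | .coin, _ => (PMF.uniformOfFintype Bool).bind fun b => emit 0 (Data.ofBool b)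
  | .query p, env => (p.eval O env).bind fun a => emit a.2 (O a.1)

/-- The distribution of the pair (output, running time) on the input `d`, with the oracle `O`. -/
noncomputable def Prog.run (O : Data → Data) (P : Prog) (d : Data) : PMF (Data × ℕ) :=
  P.eval O [d]

/-- The distribution of the output on the input `d`, with the oracle `O`. -/
noncomputable def Prog.output (O : Data → Data) (P : Prog) (d : Data) : PMF Data :=
  (P.run O d).map Prod.fst

/-- The oracle that is supplied to programs that use none. -/
def noOracle : Data → Data := fun _ => Data.nil

/-- A sequence of numbers is bounded by a polynomial in the security parameter. -/
def PolyBounded (f : ℕ → ℕ) : Prop := ∃ p : Polynomial ℕ, ∀ n, f n ≤ p.eval n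

/-- Probabilistic polynomial-time algorithms: programs without oracle whose running time is, for
every outcome of the coins, bounded by a polynomial in the size of the input. -/
def Prog.IsPPT (P : Prog) : Prop :=
  P.OracleFree ∧ ∃ p : Polynomial ℕ, ∀ d : Data, ∀ o ∈ (P.run noOracle d).support,
    o.2 ≤ p.eval d.size

/-- Negligible functions of the security parameter. -/
def Negligible (f : ℕ → ℝ) : Prop :=
  Asymptotics.SuperpolynomialDecay Filter.atTop (fun n : ℕ => (n : ℝ)) f

/-- The probability that the bit (value) drawn from `X` is `1` (not `nil`). -/
noncomputable def acceptProb (X : PMF Data) : ℝ := (X.toOuterMeasure {d | d ≠ Data.nil}).toReal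

/-- Computational indistinguishability of two sequences of distributions: every probabilistic
polynomial-time distinguisher, which gets `1ⁿ`, an advice of polynomial size and a sample, has a
negligible advantage. -/
def Indistinguishable (X Y : ℕ → PMF Data) : Prop :=
  ∀ D : Prog, D.IsPPT → ∀ advice : ℕ → Data, PolyBounded (fun n => (advice n).size) →
    Negligible fun n =>
      |acceptProb ((X n).bind fun w =>
          D.output noOracle (Data.ofList [Data.ofNat n, advice n, w])) -
        acceptProb ((Y n).bind fun w =>
          D.output noOracle (Data.ofList [Data.ofNat n, advice n, w]))|

/-! ## Pseudorandom permutations -/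

/-- A family of keyed permutations: for the security parameter `n`, every key in `{0,1}ⁿ` selects a
permutation of `{0,1}^u` where `u = blockLen n`. -/
structure KeyedPerm where
  /-- the block length `u` -/
  blockLen : ℕ → ℕ
  /-- the permutation that belongs to a key -/
  perm : ∀ n, BitVec n → Equiv.Perm (BitVec (blockLen n))

/-- Oracle access to a permutation of `{0,1}^u` (other queries are answered by `nil`). -/
noncomputable def permOracle {u : ℕ} (π : Equiv.Perm (BitVec u)) : Data → Data :=
  Function.extend Data.ofBits (fun x => Data.ofBits (π x)) (fun _ => Data.nil)

/-- The input of an adversary against a family of keyed permutations: `1ⁿ`, `1ᵘ` and the advice. -/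
def KeyedPerm.advInput (E : KeyedPerm) (advice : ℕ → Data) (n : ℕ) : Data :=
  Data.ofList [Data.ofNat n, Data.ofNat (E.blockLen n), advice n]

/-- A secure pseudorandom permutation. -/
structure KeyedPerm.IsSecurePRP (E : KeyedPerm) : Prop where
  /-- The block length is polynomial in the security parameter. -/
  blockLen_poly : PolyBounded E.blockLen
  /-- Some polynomial-time algorithm computes `E.perm n k x` from `1ⁿ`, `k` and `x`. -/
  computable : ∃ P : Prog, P.IsPPT ∧ ∀ (n : ℕ) (k : BitVec n) (x : BitVec (E.blockLen n)),
    P.output noOracle (Data.ofList [Data.ofNat n, Data.ofBits k, Data.ofBits x]) =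
      PMF.pure (Data.ofBits (E.perm n k x))
  /-- No probabilistic polynomial-time oracle algorithm with an advice of polynomial size can tell
  `E.perm n k`, for a uniform key `k`, from a uniform permutation. -/
  pseudorandom : ∀ A : Prog, ∀ advice : ℕ → Data, PolyBounded (fun n => (advice n).size) →
    (∃ p : Polynomial ℕ, ∀ (n : ℕ) (π : Equiv.Perm (BitVec (E.blockLen n))),
      ∀ o ∈ (A.run (permOracle π) (E.advInput advice n)).support, o.2 ≤ p.eval n) →
    Negligible fun n =>
      |acceptProb ((PMF.uniformOfFintype (BitVec n)).bind fun k =>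
          A.output (permOracle (E.perm n k)) (E.advInput advice n)) -
        acceptProb ((PMF.uniformOfFintype (Equiv.Perm (BitVec (E.blockLen n)))).bind fun π =>
          A.output (permOracle π) (E.advInput advice n))|

/-! ## The functionality, the leakage and the notion of security

The two groups are indexed by `Bool` (`false` is group 0, `true` is group 1, and `!j` is the group
opposite to `j`); the clients of a group are indexed by `Fin m`. -/

/-- The clients' sets: `S j i` is the set of the `i`-th client of group `j`, a set of `u`-bit
strings. -/
abbrev Inputs (m u : ℕ) : Type := Bool → Fin m → Finset (BitVec u)

/-- No two clients of the same group have an element in common. -/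
def Inputs.GroupDisjoint {m u : ℕ} (S : Inputs m u) : Prop :=
  ∀ j : Bool, Pairwise fun i i' : Fin m => Disjoint (S j i) (S j i')

/-- The group PSI functionality: the `i`-th client of group `j` receives the vector of the
intersections of its set with the sets of the clients of the other group. (The third party has no
input and receives nothing.) -/
def functionality {m u : ℕ} (S : Inputs m u) (j : Bool) (i : Fin m) : Fin m → Finset (BitVec u) :=
  fun l => S j i ∩ S (!j) l

/-- The pair-wise intersection cardinality. -/
def pairwiseCard {m u : ℕ} (S : Inputs m u) (j : Bool) (i l : Fin m) : ℕ :=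
  (S j i ∩ S (!j) l).card

/-- A protocol for `2 * m` clients and a third party, seen through the (encoded) views of the
parties in a random execution with given inputs. -/
structure Protocol (m : ℕ) (blockLen : ℕ → ℕ) where
  /-- the view of the `i`-th client of group `j` -/
  clientView : ∀ n, Inputs m (blockLen n) → Bool → Fin m → PMF Data
  /-- the view of the third party -/
  thirdPartyView : ∀ n, Inputs m (blockLen n) → PMF Data

/-- A sequence of admissible inputs: the sets within a group are disjoint and their sizes are
polynomial in the security parameter. -/
structure Admissible {m : ℕ} {blockLen : ℕ → ℕ} (S : ∀ n, Inputs m (blockLen n)) : Prop where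
  disjoint : ∀ n, (S n).GroupDisjoint
  card_poly : ∀ j i, PolyBounded fun n => (S n j i).card

/-- The data that every simulator gets for free: `1ⁿ` and `1ᵘ`. -/
def publicParams (blockLen : ℕ → ℕ) (n : ℕ) : Data :=
  Data.node (Data.ofNat n) (Data.ofNat (blockLen n))

/-- The input of a client's simulator: the public parameters, the client's set and its output of
the functionality. -/
def clientSimInput {m : ℕ} (blockLen : ℕ → ℕ) (n : ℕ) (S : Inputs m (blockLen n))
    (j : Bool) (i : Fin m) : Data :=
  Data.ofList [publicParams blockLen n, Data.ofFinset (S j i),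
    Data.ofVec fun l => Data.ofFinset (functionality S j i l)]

/-- A pair of vectors of values, one for each group. -/
def ofGroups {m : ℕ} (f : Bool → Fin m → Data) : Data :=
  Data.node (Data.ofVec (f false)) (Data.ofVec (f true))

/-- The input of the third party's simulator: the public parameters, the (public) sizes of the
clients' sets, and the leakage. -/
def thirdPartySimInput {m : ℕ} (blockLen : ℕ → ℕ)
    (L : ∀ u, Inputs m u → Bool → Fin m → Fin m → ℕ) (n : ℕ) (S : Inputs m (blockLen n)) : Data :=
  Data.ofList [publicParams blockLen n,
    ofGroups fun j i => Data.ofNat (S j i).card,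
    ofGroups fun j i => Data.ofVec fun l => Data.ofNat (L _ S j i l)]

/-- The protocol securely realizes the group PSI functionality with the leakage `L` to the third
party, against static semi-honest adversaries that corrupt one party. -/
def SecurelyRealizes {m : ℕ} {blockLen : ℕ → ℕ} (Γ : Protocol m blockLen)
    (L : ∀ u, Inputs m u → Bool → Fin m → Fin m → ℕ) : Prop :=
  (∀ (j : Bool) (i : Fin m), ∃ Sim : Prog, Sim.IsPPT ∧
    ∀ S : (∀ n, Inputs m (blockLen n)), Admissible S →
      Indistinguishable (fun n => Sim.output noOracle (clientSimInput blockLen n (S n) j i))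
        (fun n => Γ.clientView n (S n) j i)) ∧
  (∃ Sim : Prog, Sim.IsPPT ∧
    ∀ S : (∀ n, Inputs m (blockLen n)), Admissible S →
      Indistinguishable (fun n => Sim.output noOracle (thirdPartySimInput blockLen L n (S n)))
        (fun n => Γ.thirdPartyView n (S n)))

/-! ## The protocol EG-PSI (first variant) -/

section Execution

variable {m n u : ℕ} (F : BitVec n → Equiv.Perm (BitVec u)) (K : Fin m → Fin m → BitVec n)
  (S : Inputs m u)

/-- The key that the `i`-th client of group `j` shares with the `l`-th client of the other group;
`K i l` is the key that the `i`-th client of group 0 picks for the `l`-th client of group 1. -/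
def sharedKey (j : Bool) (i l : Fin m) : BitVec n :=
  match j with
  | false => K i l
  | true => K l i

/-- The triples (ciphertext, key, index) that a client keeps. -/
def triples (j : Bool) (i : Fin m) : Finset (BitVec u × BitVec n × Fin m) :=
  Finset.univ.biUnion fun l =>
    (S j i).image fun e => (F (sharedKey K j i l) e, sharedKey K j i l, l)

/-- The set of ciphertexts that a client sends to the TEE. -/
def encSet (j : Bool) (i : Fin m) : Finset (BitVec u) :=
  Finset.univ.biUnion fun l => (S j i).image fun e => F (sharedKey K j i l) e

/-- What the TEE sends to a client: those of the client's ciphertexts that appear more than once in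
the collection of all the clients' encrypted sets. -/
def teeReply (j : Bool) (i : Fin m) : Finset (BitVec u) :=
  (encSet F K S j i).filter fun c =>
    1 < (Finset.univ.filter fun a : Bool × Fin m => c ∈ encSet F K S a.1 a.2).card

/-- The output of a client: every ciphertext in the TEE's reply is looked up among the triples and
decrypted into the component given by the index. -/
def clientOutput (j : Bool) (i l : Fin m) : Finset (BitVec u) :=
  ((triples F K S j i).filter fun t => t.1 ∈ teeReply F K S j i ∧ t.2.2 = l).image
    fun t => (F t.2.1).symm t.1

/-- The random coins of a client: the clients of group 0 pick the keys, those of group 1 toss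
none. -/
def clientCoins (j : Bool) (i : Fin m) : Data :=
  match j with
  | false => Data.ofVec fun l => Data.ofBits (K i l)
  | true => Data.nil

/-- The keys that a client receives: the clients of group 1 get one from each client of group 0. -/
def receivedKeys (j : Bool) (i : Fin m) : Data :=
  match j with
  | false => Data.nil
  | true => Data.ofVec fun l => Data.ofBits (K l i)

/-- The view of a client: its set, its coins, the keys received, the TEE's reply, its output. -/
def clientViewData (j : Bool) (i : Fin m) : Data :=
  Data.ofList [Data.ofFinset (S j i), clientCoins K j i, receivedKeys K j i,
    Data.ofFinset (teeReply F K S j i), Data.ofVec fun l => Data.ofFinset (clientOutput F K S j i l)]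

/-- The view of the TEE: the encrypted sets of all clients. -/
def teeViewData : Data := ofGroups fun j i => Data.ofFinset (encSet F K S j i)

end Execution

/-- The first variant of EG-PSI: the `m * m` keys are uniform and independent. -/
noncomputable def egPSI1 (m : ℕ) (E : KeyedPerm) : Protocol m E.blockLen where
  clientView n S j i := (PMF.uniformOfFintype (Fin m → Fin m → BitVec n)).map fun K =>
    clientViewData (E.perm n) K S j i
  thirdPartyView n S := (PMF.uniformOfFintype (Fin m → Fin m → BitVec n)).map fun K =>
    teeViewData (E.perm n) K S

end GPSI

namespace GPSI

open scoped BigOperators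
open Finset Function

/-! ## Uniform averages and acceptance probabilities -/

/-! Corrupted client. Under one uniform key, a fixed string is mapped to a fixed string with
probability at most $2^{-u}$ plus a negligible term, since otherwise a single query would tell the
PRP from a uniform permutation (`KeyedPerm.IsSecurePRP.point_bound`). The keys of different pairs of
clients are independent, so by a union bound ciphertexts of different pairs almost never coincide
(`expect_collision_keys_le`). Without such a coincidence, two clients send the same ciphertext only
if they share its key and both hold its plaintext. Hence the TEE's reply consists of the encrypted
intersections and the client's output is correct (`NoCollision.teeReply_eq`,
`NoCollision.clientOutput_eq`). The view is then a function of the client's set, its ideal output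
and its own uniform keys, and the simulator evaluates this function on keys that it draws itself.

Corrupted TEE. The $m^2$ encryption functions are replaced one at a time by independent uniform
functions (`hybrid_bound_matrix`). One replacement costs the PRP advantage of an adversary that runs
the distinguisher (`hybridProg_output`), plus the distance between a uniform permutation and a
uniform function on polynomially many points (`switching`). The ciphertexts of all other pairs are
part of the adversary's advice, so the bound holds for every fixed choice of the other functions
(`KeyedPerm.IsSecurePRP.uniform_advantage`). With uniform functions the simulation is perfect: for a
pair of clients, the values on the intersection of their sets and on the two differences are
independent uniform strings, and the set sizes and the leakage say how many of each are needed
(`thirdPartySim_output`).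

The rest shows that the simulators and adversaries, written as concrete programs, compute what they
should in polynomial time. The delicate construct is iteration, which is harmless when each round
enlarges the accumulator only additively (`Prog.PolyTime.fold`). Sorting (`sortProg_ofList`) gives
sets their canonical encoding, so that the order in which ciphertexts are produced does not matter.
-/

theorem acceptProb_nonneg (X : PMF Data) : 0 ≤ acceptProb X := ENNReal.toReal_nonneg

theorem toOuterMeasure_le_one (X : PMF Data) (s : Set Data) : X.toOuterMeasure s ≤ 1 := by
  rw [PMF.toOuterMeasure_apply, ← X.tsum_coe]
  exact ENNReal.tsum_le_tsum fun x => Set.indicator_le_self _ _ x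

theorem acceptProb_le_one (X : PMF Data) : acceptProb X ≤ 1 :=
  ENNReal.toReal_le_of_le_ofReal zero_le_one (by simpa using toOuterMeasure_le_one X _)

theorem acceptProb_pure (d : Data) [Decidable (d ≠ Data.nil)] :
    acceptProb (PMF.pure d) = if d ≠ Data.nil then 1 else 0 := by
  classical
  rw [acceptProb, PMF.toOuterMeasure_pure_apply]
  by_cases h : d = Data.nil <;> simp [h]

theorem acceptProb_bind_uniform {A : Type*} [Fintype A] [Nonempty A] (Q : A → PMF Data) :
    acceptProb ((PMF.uniformOfFintype A).bind Q) = 𝔼 a, acceptProb (Q a) := by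
  rw [acceptProb, PMF.toOuterMeasure_bind_apply, tsum_fintype, ENNReal.toReal_sum]
  · simp only [PMF.uniformOfFintype_apply, ENNReal.toReal_mul, ENNReal.toReal_inv,
      ENNReal.toReal_natCast, Fintype.expect_eq_sum_div_card, acceptProb]
    rw [← Finset.mul_sum, div_eq_inv_mul]
  · intro a _
    refine ENNReal.mul_ne_top (PMF.apply_ne_top _ _) ?_
    exact ne_top_of_le_ne_top ENNReal.one_ne_top (toOuterMeasure_le_one _ _)

/-! ### Resampling one coordinate, and hybrid arguments -/

section Resample

variable {ι A : Type*} [DecidableEq ι]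

/-- Exchanging the value of a function at a point with a given value. -/
def swapAt (i : ι) : Equiv.Perm ((ι → A) × A) :=
  Function.Involutive.toPerm (fun p => (update p.1 i p.2, p.1 i)) (by
    rintro ⟨f, a⟩
    simp)

/-- The exchange `swapAt i` is a bijection of the product space, so drawing one coordinate afresh
does not change the average. Independence of coordinates is used in this form. -/
theorem expect_update [Fintype ι] [Fintype A] [Nonempty A] (i : ι) (φ : (ι → A) → ℝ) :
    𝔼 f, φ f = 𝔼 f, 𝔼 a, φ (update f i a) := by
  have h1 : 𝔼 p : (ι → A) × A, φ p.1 = 𝔼 p : (ι → A) × A, φ (update p.1 i p.2) :=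
    (Fintype.expect_equiv (swapAt i) _ _ fun p => rfl).symm
  rw [← univ_product_univ, expect_product, expect_product] at h1
  simpa using h1

end Resample

theorem expect_fin_cons {C D : Type*} [Fintype D] {k : ℕ} (χ : D → C) (Φ : (Fin (k + 1) → C) → ℝ) :
    𝔼 a : Fin (k + 1) → D, Φ (fun i => χ (a i)) =
      𝔼 a₀, 𝔼 a : Fin k → D, Φ (Fin.cons (χ a₀) fun i => χ (a i)) := by
  rw [← expect_product' univ univ
    (fun a₀ (a : Fin k → D) => Φ (Fin.cons (χ a₀) fun i => χ (a i))), univ_product_univ]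
  refine (Fintype.expect_equiv (Fin.consEquiv fun _ => D) _ _ fun p => ?_).symm
  congr 1
  funext i
  refine Fin.cases ?_ (fun i => ?_) i <;> simp [Fin.consEquiv]

/-- Induction on `k`: with the first coordinate fixed the others are exchanged, then the first one
is. As `h` is assumed for every fixed choice `g` of the other coordinates, it survives averaging
over them. -/
theorem hybrid_bound {A B C : Type*} [Fintype A] [Fintype B] [Nonempty A] [Nonempty B]
    (φ : A → C) (ψ : B → C) (ε : ℝ) (k : ℕ) (Φ : (Fin k → C) → ℝ)
    (h : ∀ i g, |𝔼 a, Φ (update g i (φ a)) - 𝔼 b, Φ (update g i (ψ b))| ≤ ε) :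
    |𝔼 a : Fin k → A, Φ (fun i => φ (a i)) - 𝔼 b : Fin k → B, Φ (fun i => ψ (b i))| ≤ k * ε := by
  induction k with
  | zero =>
    have h0 : ∀ g g' : Fin 0 → C, Φ g = Φ g' := fun g g' => by rw [Subsingleton.elim g g']
    simp [fun g => h0 g Fin.elim0]
  | succ k ih =>
    have hA : |𝔼 a₀, (𝔼 a : Fin k → A, Φ (Fin.cons (φ a₀) fun i => φ (a i)) -
        𝔼 b : Fin k → B, Φ (Fin.cons (φ a₀) fun i => ψ (b i)))| ≤ k * ε := by
      refine (abs_expect_le _ _).trans (expect_le univ_nonempty fun a₀ _ => ?_)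
      refine ih (fun g => Φ (Fin.cons (φ a₀) g)) fun i g => ?_
      simpa only [Fin.cons_update] using h i.succ (Fin.cons (φ a₀) g)
    have hB : |𝔼 b : Fin k → B, (𝔼 a₀, Φ (Fin.cons (φ a₀) fun i => ψ (b i)) -
        𝔼 b₀, Φ (Fin.cons (ψ b₀) fun i => ψ (b i)))| ≤ ε := by
      refine (abs_expect_le _ _).trans (expect_le univ_nonempty fun b _ => ?_)
      have := h 0 (Fin.cons (ψ (Classical.arbitrary B)) fun i => ψ (b i))
      simpa only [Fin.update_cons_zero] using this
    rw [expect_sub_distrib] at hA hB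
    rw [expect_fin_cons φ, expect_fin_cons ψ]
    rw [expect_comm univ univ (fun (b : Fin k → B) a₀ => Φ (Fin.cons (φ a₀) fun i => ψ (b i))),
      expect_comm univ univ (fun (b : Fin k → B) b₀ => Φ (Fin.cons (ψ b₀) fun i => ψ (b i)))] at hB
    push_cast
    rw [abs_le] at *
    constructor <;> linarith [hA.1, hA.2, hB.1, hB.2]

/-- The vector version is applied twice: to the rows, and to the entries within the row being
exchanged. -/
theorem hybrid_bound_matrix {A B C : Type*} [Fintype A] [Fintype B] [Nonempty A] [Nonempty B]
    (φ : A → C) (ψ : B → C) (ε : ℝ) (k l : ℕ) (Φ : (Fin k → Fin l → C) → ℝ)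
    (h : ∀ i j g, |𝔼 a, Φ (update g i (update (g i) j (φ a))) -
      𝔼 b, Φ (update g i (update (g i) j (ψ b)))| ≤ ε) :
    |𝔼 a : Fin k → Fin l → A, Φ (fun i j => φ (a i j)) -
      𝔼 b : Fin k → Fin l → B, Φ (fun i j => ψ (b i j))| ≤ k * (l * ε) := by
  refine hybrid_bound (fun (a : Fin l → A) j => φ (a j)) (fun (b : Fin l → B) j => ψ (b j)) _ k Φ
    fun i g => ?_
  refine hybrid_bound φ ψ ε l (fun c => Φ (update g i c)) fun j g' => ?_
  simpa using h i j (update g i g')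

theorem expect_eval_eq {α : Type*} [Fintype α] [DecidableEq α] (x : α) {β : Type*} [Fintype β]
    [DecidableEq β] [Nonempty β] (y : β) :
    𝔼 f : α → β, (if f x = y then (1 : ℝ) else 0) = 1 / Fintype.card β := by
  rw [expect_update x]
  simp

/-! ### Random permutations versus random functions -/

section Switching

variable {α : Type*} [Fintype α] [DecidableEq α] [Nonempty α]

/-- Union bound over the ordered pairs of distinct points: resampling the value at the first point
makes it hit the value at the second with probability `1 / Fintype.card α`. -/
theorem expect_collision_le (T : Finset α) :
    𝔼 f : α → α, (if Set.InjOn f (T : Set α) then (0 : ℝ) else 1) ≤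
      (T.card : ℝ) ^ 2 / Fintype.card α := by
  classical
  have h1 : ∀ f : α → α, (if Set.InjOn f (T : Set α) then (0 : ℝ) else 1) ≤
      ∑ p ∈ T.offDiag, if f p.1 = f p.2 then (1 : ℝ) else 0 := by
    intro f
    split_ifs with hf
    · exact sum_nonneg fun p _ => by split_ifs <;> norm_num
    · simp only [Set.InjOn, not_forall] at hf
      obtain ⟨x, hx, y, hy, hxy, hne⟩ := hf
      refine le_trans ?_ (single_le_sum (f := fun p : α × α => if f p.1 = f p.2 then (1 : ℝ) else 0)
        (fun p _ => by split_ifs <;> norm_num)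
        (show (x, y) ∈ T.offDiag from mem_offDiag.2 ⟨mem_coe.1 hx, mem_coe.1 hy, hne⟩))
      simp [hxy]
  refine (expect_le_expect fun f _ => h1 f).trans ?_
  rw [expect_sum_comm]
  have h2 : ∀ p ∈ T.offDiag, 𝔼 f : α → α, (if f p.1 = f p.2 then (1 : ℝ) else 0) =
      1 / Fintype.card α := by
    rintro ⟨x, y⟩ hp
    have hne : y ≠ x := (mem_offDiag.1 hp).2.2.symm
    rw [expect_update x]
    simp [update_of_ne hne]
  rw [sum_congr rfl h2, sum_const, nsmul_eq_mul, mul_one_div]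
  gcongr
  have : T.offDiag.card ≤ T.card ^ 2 := by
    rw [offDiag_card, sq]; exact Nat.sub_le _ _
  exact_mod_cast this

/-- Random permutations and random functions are close on few points. -/
theorem switching (T : Finset α) (Φ : (α → α) → ℝ) (h0 : ∀ f, 0 ≤ Φ f) (h1 : ∀ f, Φ f ≤ 1)
    (hT : ∀ f g, (∀ x ∈ T, f x = g x) → Φ f = Φ g) :
    |𝔼 π : Equiv.Perm α, Φ π - 𝔼 f : α → α, Φ f| ≤
      𝔼 f : α → α, (if Set.InjOn f (T : Set α) then (0 : ℝ) else 1) := by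
  classical
  -- Composing a uniform function with a uniform permutation leaves it uniform. Both averages can
  -- now be compared for each fixed `f`.
  have e1 : 𝔼 f : α → α, Φ f = 𝔼 f : α → α, 𝔼 π : Equiv.Perm α, Φ (π ∘ f) := by
    rw [expect_comm]
    have : ∀ π : Equiv.Perm α, 𝔼 f : α → α, Φ (π ∘ f) = 𝔼 f : α → α, Φ f := fun π =>
      Fintype.expect_equiv (Equiv.arrowCongr (Equiv.refl α) π) _ _ fun f => rfl
    simp_rw [this]
    exact (Fintype.expect_const _).symm
  have e2 : 𝔼 π : Equiv.Perm α, Φ π = 𝔼 _f : α → α, 𝔼 π : Equiv.Perm α, Φ π :=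
    (Fintype.expect_const _).symm
  rw [e1, e2, ← expect_sub_distrib]
  refine (abs_expect_le _ _).trans (expect_le_expect fun f _ => ?_)
  split_ifs with hf
  -- An `f` that is injective on `T` agrees there with a permutation. Right multiplication by it
  -- permutes the permutations, and `Φ` only sees values on `T`, so the two averages are equal. For
  -- any other `f` they differ by at most `1`.
  · obtain ⟨σ, hσ⟩ := exists_equiv_extend_of_card_eq (t := (univ : Finset α)) (by simp)
      (s := T) (f := f) (by simp) hf
    have : 𝔼 π : Equiv.Perm α, Φ (π ∘ f) = 𝔼 π : Equiv.Perm α, Φ π := by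
      let τ : Equiv.Perm α := σ.trans (Equiv.subtypeUnivEquiv (by simp))
      refine Fintype.expect_equiv (Equiv.mulRight τ) _ _ fun π => hT _ _ fun x hx => ?_
      have : f x = τ x := (hσ x hx).symm
      simp [this]
    rw [this]; simp
  · have a0 : 0 ≤ 𝔼 π : Equiv.Perm α, Φ π := expect_nonneg fun _ _ => h0 _
    have b0 : 0 ≤ 𝔼 π : Equiv.Perm α, Φ (π ∘ f) := expect_nonneg fun _ _ => h0 _
    have a1 : 𝔼 π : Equiv.Perm α, Φ π ≤ 1 := expect_le univ_nonempty fun _ _ => h1 _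
    have b1 : 𝔼 π : Equiv.Perm α, Φ (π ∘ f) ≤ 1 := expect_le univ_nonempty fun _ _ => h1 _
    rw [abs_le]; constructor <;> linarith

/-- Every function is injective on a single point, so `switching` holds there with error `0`. -/
theorem expect_perm_apply_eq (x y : α) :
    𝔼 π : Equiv.Perm α, (if π x = y then (1 : ℝ) else 0) = 1 / Fintype.card α := by
  have h := switching {x} (fun f => if f x = y then (1 : ℝ) else 0)
    (fun f => by split_ifs <;> norm_num)
    (fun f => by split_ifs <;> norm_num) (fun f g h => by simp [h x (by simp)])
  simp only [coe_singleton, Set.injOn_singleton, if_true, expect_eval_eq] at h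
  rw [Fintype.expect_const] at h
  exact sub_eq_zero.1 (abs_nonpos_iff.1 h)

end Switching

/-! ## Negligible functions -/

theorem Negligible.mono {f g : ℕ → ℝ} (hg : Negligible g) (h0 : ∀ n, 0 ≤ f n)
    (h : ∀ n, f n ≤ g n) : Negligible f :=
  Asymptotics.SuperpolynomialDecay.trans_abs_le hg fun n => by
    rw [abs_of_nonneg (h0 n)]; exact (h n).trans (le_abs_self _)

theorem Negligible.add {f g : ℕ → ℝ} (hf : Negligible f) (hg : Negligible g) :
    Negligible fun n => f n + g n := Asymptotics.SuperpolynomialDecay.add hf hg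

theorem Negligible.const_mul {f : ℕ → ℝ} (hf : Negligible f) (c : ℝ) :
    Negligible fun n => c * f n := Asymptotics.SuperpolynomialDecay.const_mul hf c

theorem Negligible.zero : Negligible fun _ => 0 :=
  Asymptotics.superpolynomialDecay_zero _ _

theorem Negligible.sum {ι : Type*} (s : Finset ι) {f : ι → ℕ → ℝ} (h : ∀ i, Negligible (f i)) :
    Negligible fun n => ∑ i ∈ s, f i n := by
  classical
  induction s using Finset.induction_on with
  | empty => simpa using Negligible.zero
  | insert a s ha ih => simpa only [sum_insert ha] using (h a).add ih

theorem Negligible.poly_mul {f : ℕ → ℝ} (hf : Negligible f) (h0 : ∀ n, 0 ≤ f n) {N : ℕ → ℕ}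
    (hN : PolyBounded N) : Negligible fun n => (N n : ℝ) * f n := by
  obtain ⟨p, hp⟩ := hN
  have h := Asymptotics.SuperpolynomialDecay.polynomial_mul hf (p.map (Nat.castRingHom ℝ))
  refine Negligible.mono h (fun n => mul_nonneg (Nat.cast_nonneg _) (h0 n)) fun n => ?_
  refine mul_le_mul_of_nonneg_right ?_ (h0 n)
  have : ((p.eval n : ℕ) : ℝ) = (p.map (Nat.castRingHom ℝ)).eval (n : ℝ) :=
    (Polynomial.eval_natCast_map (Nat.castRingHom ℝ) p n).symm
  rw [← this]
  exact_mod_cast hp n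

/-! ## Polynomial bounds -/

/-- Coefficients in `ℕ` are nonnegative. Composition of time bounds rests on this monotonicity. -/
theorem eval_mono (p : Polynomial ℕ) : Monotone fun n => p.eval n := by
  intro a b h
  simp only [Polynomial.eval_eq_sum, Polynomial.sum]
  gcongr

theorem PolyBounded.mono {f g : ℕ → ℕ} (hg : PolyBounded g) (h : ∀ n, f n ≤ g n) :
    PolyBounded f := by
  obtain ⟨p, hp⟩ := hg
  exact ⟨p, fun n => (h n).trans (hp n)⟩

theorem PolyBounded.add {f g : ℕ → ℕ} (hf : PolyBounded f) (hg : PolyBounded g) :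
    PolyBounded fun n => f n + g n := by
  obtain ⟨p, hp⟩ := hf
  obtain ⟨q, hq⟩ := hg
  exact ⟨p + q, fun n => by rw [Polynomial.eval_add]; exact add_le_add (hp n) (hq n)⟩

theorem PolyBounded.mul {f g : ℕ → ℕ} (hf : PolyBounded f) (hg : PolyBounded g) :
    PolyBounded fun n => f n * g n := by
  obtain ⟨p, hp⟩ := hf
  obtain ⟨q, hq⟩ := hg
  exact ⟨p * q, fun n => by rw [Polynomial.eval_mul]; exact Nat.mul_le_mul (hp n) (hq n)⟩

theorem PolyBounded.const (c : ℕ) : PolyBounded fun _ => c :=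
  ⟨Polynomial.C c, fun n => by simp⟩

theorem PolyBounded.id : PolyBounded fun n => n := ⟨Polynomial.X, fun n => by simp⟩

theorem PolyBounded.sum {ι : Type*} (s : Finset ι) {f : ι → ℕ → ℕ} (h : ∀ i, PolyBounded (f i)) :
    PolyBounded fun n => ∑ i ∈ s, f i n := by
  classical
  induction s using Finset.induction_on with
  | empty => simpa using PolyBounded.const 0
  | insert a s ha ih => simpa only [sum_insert ha] using (h a).add ih

theorem PolyBounded.comp (p : Polynomial ℕ) {f : ℕ → ℕ} (hf : PolyBounded f) :
    PolyBounded fun n => p.eval (f n) := by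
  obtain ⟨q, hq⟩ := hf
  exact ⟨p.comp q, fun n => by rw [Polynomial.eval_comp]; exact eval_mono p (hq n)⟩

end GPSI

namespace GPSI

/-! ## Outputs of programs -/

/-- The distribution of the final value of an iteration. -/
noncomputable def foldVal (f : Data → Data → PMF Data) : List Data → Data → PMF Data
  | [], a => PMF.pure a
  | x :: xs, a => (f x a).bind fun y => foldVal f xs y

/-- The distribution of the value of a program in an environment. -/
noncomputable def Prog.val (O : Data → Data) (P : Prog) (env : List Data) : PMF Data :=
  (P.eval O env).map Prod.fst

theorem Prog.output_eq_val (O : Data → Data) (P : Prog) (d : Data) : P.output O d = P.val O [d] :=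
  rfl

theorem map_fst_emit (c : ℕ) (d : Data) : (emit c d).map Prod.fst = PMF.pure d :=
  PMF.pure_map _ _

theorem foldTime_map_fst (f : Data → Data → PMF (Data × ℕ)) (l : List Data) (a : Data) (c : ℕ) :
    (foldTime f l a c).map Prod.fst = foldVal (fun x y => (f x y).map Prod.fst) l a := by
  induction l generalizing a c with
  | nil => exact PMF.pure_map _ _
  | cons x xs ih => simp only [foldTime, foldVal, PMF.map_bind, ih, PMF.bind_map, Function.comp_def]

namespace Prog

variable (O : Data → Data) (env : List Data) (p q r : Prog)

theorem val_var (i : ℕ) : (var i).val O env = PMF.pure (env.getD i Data.nil) :=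
  map_fst_emit _ _

theorem val_nil : nil.val O env = PMF.pure Data.nil := map_fst_emit _ _

theorem val_pair : (pair p q).val O env =
    (p.val O env).bind fun a => (q.val O env).bind fun b => PMF.pure (Data.node a b) := by
  simp only [val, eval, PMF.map_bind, map_fst_emit, PMF.bind_map, Function.comp_def]

theorem val_fst : (fst p).val O env = (p.val O env).bind fun a => PMF.pure a.fst := by
  simp only [val, eval, PMF.map_bind, map_fst_emit, PMF.bind_map, Function.comp_def]

theorem val_snd : (snd p).val O env = (p.val O env).bind fun a => PMF.pure a.snd := by
  simp only [val, eval, PMF.map_bind, map_fst_emit, PMF.bind_map, Function.comp_def]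

/-- Case distinction on whether a value is `nil`. -/
def _root_.GPSI.Data.ite {α : Type*} (d : Data) (x y : α) : α :=
  match d with
  | .nil => y
  | .node _ _ => x

theorem val_cond : (cond p q r).val O env =
    (p.val O env).bind fun a => a.ite (q.val O env) (r.val O env) := by
  simp only [val, eval, PMF.map_bind, PMF.bind_map, Function.comp_def]
  congr 1
  funext a
  cases a.1 <;> simp only [Data.ite, PMF.map_bind, map_fst_emit] <;> rfl

theorem val_letIn : (letIn p q).val O env = (p.val O env).bind fun a => q.val O (a :: env) := by
  simp only [val, eval, PMF.map_bind, map_fst_emit, PMF.bind_map, Function.comp_def]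
  rfl

theorem val_call : (call q p).val O env = (p.val O env).bind fun a => q.val O [a] := by
  simp only [val, eval, PMF.map_bind, map_fst_emit, PMF.bind_map, Function.comp_def]
  rfl

theorem val_fold : (fold p q r).val O env = (p.val O env).bind fun l => (q.val O env).bind fun a =>
    foldVal (fun x y => r.val O (x :: y :: env)) l.toList a := by
  simp only [val, eval, PMF.map_bind, map_fst_emit, PMF.bind_map, Function.comp_def]
  congr 1; funext l; congr 1; funext a
  exact foldTime_map_fst _ _ _ _

theorem val_coin : coin.val O env =
    (PMF.uniformOfFintype Bool).bind fun b => PMF.pure (Data.ofBool b) := by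
  simp only [val, eval, PMF.map_bind, map_fst_emit]

theorem val_query : (query p).val O env = (p.val O env).bind fun a => PMF.pure (O a) := by
  simp only [val, eval, PMF.map_bind, map_fst_emit, PMF.bind_map, Function.comp_def]

/-- Evaluation of a program that never uses its oracle does not depend on the oracle. -/
theorem OracleFree.eval_eq {P : Prog} (h : P.OracleFree) (O O' : Data → Data) (env : List Data) :
    P.eval O env = P.eval O' env := by
  induction P generalizing env with
  | var | nil | coin => rfl
  | pair p q ihp ihq => simp only [eval, ihp h.1, ihq h.2]
  | fst p ih | snd p ih => simp only [eval, ih h]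
  | cond p q r ihp ihq ihr => simp only [eval, ihp h.1, ihq h.2.1, ihr h.2.2]
  | letIn p q ihp ihq => simp only [eval, ihp h.1, ihq h.2]
  | call q p ihq ihp => simp only [eval, ihp h.2, ihq h.1]
  | fold p q r ihp ihq ihr => simp only [eval, ihp h.1, ihq h.2.1, ihr h.2.2]
  | query => exact h.elim

theorem OracleFree.val_eq {P : Prog} (h : P.OracleFree) (O O' : Data → Data) (env : List Data) :
    P.val O env = P.val O' env := by
  simp only [val, h.eval_eq O O']

/-! ### Deterministic programs -/

/-- The program uses neither coins nor the oracle. -/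
def Det : Prog → Prop
  | .var _ => True
  | .nil => True
  | .pair p q => p.Det ∧ q.Det
  | .fst p => p.Det
  | .snd p => p.Det
  | .cond p q r => p.Det ∧ q.Det ∧ r.Det
  | .letIn p q => p.Det ∧ q.Det
  | .call q p => q.Det ∧ p.Det
  | .fold p q r => p.Det ∧ q.Det ∧ r.Det
  | .coin => False
  | .query _ => False

/-- The value of a deterministic program. -/
def detVal : Prog → List Data → Data
  | .var i, env => env.getD i Data.nil
  | .nil, _ => Data.nil
  | .pair p q, env => Data.node (p.detVal env) (q.detVal env)
  | .fst p, env => (p.detVal env).fst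
  | .snd p, env => (p.detVal env).snd
  | .cond p q r, env => (p.detVal env).ite (q.detVal env) (r.detVal env)
  | .letIn p q, env => q.detVal (p.detVal env :: env)
  | .call q p, env => q.detVal [p.detVal env]
  | .fold p q r, env =>
      (p.detVal env).toList.foldl (fun a x => r.detVal (x :: a :: env)) (q.detVal env)
  | .coin, _ => Data.nil
  | .query _, _ => Data.nil

theorem _root_.GPSI.foldVal_pure (f : Data → Data → Data) (l : List Data) (a : Data) :
    foldVal (fun x y => PMF.pure (f x y)) l a = PMF.pure (l.foldl (fun y x => f x y) a) := by
  induction l generalizing a with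
  | nil => rfl
  | cons x xs ih => simp [foldVal, ih]

theorem Det.val_eq {P : Prog} (h : P.Det) (O : Data → Data) (env : List Data) :
    P.val O env = PMF.pure (P.detVal env) := by
  induction P generalizing env with
  | var i => exact val_var ..
  | nil => exact val_nil ..
  | pair p q ihp ihq => simp [val_pair, ihp h.1, ihq h.2, detVal]
  | fst p ih => rw [val_fst, ih h]; simp [detVal]
  | snd p ih => rw [val_snd, ih h]; simp [detVal]
  | cond p q r ihp ihq ihr =>
    rw [val_cond, ihp h.1, ihq h.2.1, ihr h.2.2, PMF.pure_bind, detVal]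
    cases p.detVal env <;> rfl
  | letIn p q ihp ihq => simp [val_letIn, ihp h.1, ihq h.2, detVal]
  | call q p ihq ihp => simp [val_call, ihp h.2, ihq h.1, detVal]
  | fold p q r ihp ihq ihr => simp [val_fold, ihp h.1, ihq h.2.1, ihr h.2.2, detVal, foldVal_pure]
  | coin | query => exact h.elim

theorem Det.oracleFree {P : Prog} (h : P.Det) : P.OracleFree := by
  induction P with
  | var | nil => trivial
  | pair p q ihp ihq => exact ⟨ihp h.1, ihq h.2⟩
  | fst p ih | snd p ih => exact ih h
  | cond p q r ihp ihq ihr => exact ⟨ihp h.1, ihq h.2.1, ihr h.2.2⟩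
  | letIn p q ihp ihq => exact ⟨ihp h.1, ihq h.2⟩
  | call q p ihq ihp => exact ⟨ihq h.1, ihp h.2⟩
  | fold p q r ihp ihq ihr => exact ⟨ihp h.1, ihq h.2.1, ihr h.2.2⟩
  | coin | query => exact h.elim

/-! ## Running times -/

/-- The total size of an environment. -/
def _root_.GPSI.envSize (env : List Data) : ℕ := (env.map Data.size).sum

@[simp] theorem _root_.GPSI.envSize_nil : envSize [] = 0 := rfl

@[simp] theorem _root_.GPSI.envSize_cons (d : Data) (env : List Data) :
    envSize (d :: env) = d.size + envSize env := by simp [envSize]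

theorem _root_.GPSI.Data.size_pos (d : Data) : 0 < d.size := by cases d <;> simp [Data.size]

theorem _root_.GPSI.Data.size_fst_le (d : Data) : d.fst.size ≤ d.size := by
  cases d <;> simp [Data.size, Data.fst]; omega

theorem _root_.GPSI.Data.size_snd_le (d : Data) : d.snd.size ≤ d.size := by
  cases d <;> simp [Data.size, Data.snd]; omega

theorem _root_.GPSI.Data.size_eq (d : Data) :
    d.size = (d.toList.map fun x => x.size + 1).sum + 1 := by
  induction d with
  | nil => rfl
  | node a b _ ih => simp [Data.size, Data.toList, ih]; omega

theorem _root_.GPSI.Data.length_toList_lt (d : Data) : d.toList.length < d.size := by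
  induction d with
  | nil => simp [Data.toList, Data.size]
  | node a b _ ih => simp [Data.toList, Data.size]; omega

theorem _root_.GPSI.Data.size_lt_of_mem {d x : Data} (h : x ∈ d.toList) : x.size < d.size := by
  induction d with
  | nil => simp [Data.toList] at h
  | node a b _ ih =>
    simp only [Data.toList, List.mem_cons, Data.size] at h ⊢
    rcases h with rfl | h
    · omega
    · have := ih h; omega

theorem _root_.GPSI.size_getD_le (env : List Data) (i : ℕ) :
    (env.getD i Data.nil).size ≤ envSize env + 1 := by
  induction env generalizing i with
  | nil => simp [Data.size]
  | cons d env ih =>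
    cases i with
    | zero => simp; omega
    | succ i => have := ih i; simp at this ⊢; omega

theorem _root_.GPSI.mem_support_emit {c : ℕ} {d : Data} {o : Data × ℕ} :
    o ∈ (emit c d).support ↔ o = (d, c + 1 + d.size) := by
  rw [emit, PMF.mem_support_pure_iff]

/-- The last action of every construct is an `emit`, which charges the size of the result. Time
bounds therefore serve as size bounds for intermediate values. -/
theorem size_le_time {O : Data → Data} {P : Prog} {env : List Data} {o : Data × ℕ}
    (h : o ∈ (P.eval O env).support) : o.1.size ≤ o.2 := by
  cases P <;>
    simp only [eval, PMF.mem_support_bind_iff, mem_support_emit] at h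
  case cond =>
    obtain ⟨a, -, h⟩ := h
    split at h <;>
      (simp only [PMF.mem_support_bind_iff, mem_support_emit] at h
       obtain ⟨b, -, rfl⟩ := h
       simp)
  case var | nil => subst h; simp
  case fst | snd | query | coin => obtain ⟨a, -, rfl⟩ := h; simp
  case pair | letIn | call => obtain ⟨a, -, b, -, rfl⟩ := h; simp
  case fold => obtain ⟨a, -, b, -, c, -, rfl⟩ := h; simp

/-- The running time is polynomial in the size of the environment and in a bound for the size of
the oracle's answers. -/
def PolyTime (P : Prog) : Prop := ∃ p : Polynomial ℕ, ∀ (B : ℕ) (O : Data → Data),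
  (∀ d, (O d).size ≤ B) → ∀ env, ∀ o ∈ (P.eval O env).support, o.2 ≤ p.eval (envSize env + B)

/-- The same for environments with a single entry. -/
def PolyTimeOn (P : Prog) : Prop := ∃ p : Polynomial ℕ, ∀ (B : ℕ) (O : Data → Data),
  (∀ d, (O d).size ≤ B) → ∀ d, ∀ o ∈ (P.eval O [d]).support, o.2 ≤ p.eval (d.size + B)

variable {p q r}

theorem PolyTime.on (h : p.PolyTime) : p.PolyTimeOn := by
  obtain ⟨t, ht⟩ := h
  exact ⟨t, fun B O hO d o ho => by simpa using ht B O hO [d] o ho⟩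

theorem IsPPT.polyTimeOn (h : p.IsPPT) : p.PolyTimeOn := by
  obtain ⟨h1, t, ht⟩ := h
  refine ⟨t, fun B O hO d o ho => (ht d o ?_).trans (eval_mono t (Nat.le_add_right _ _))⟩
  rwa [run, h1.eval_eq noOracle O]

theorem PolyTimeOn.isPPT (h : p.PolyTimeOn) (h1 : p.OracleFree) : p.IsPPT := by
  obtain ⟨t, ht⟩ := h
  -- The answers of `noOracle` have size `1`, so the bound for oracle answers is `B = 1`.
  refine ⟨h1, t.comp (Polynomial.X + 1), fun d o ho => ?_⟩
  simpa using ht 1 noOracle (fun _ => le_rfl) d o ho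

theorem PolyTime.var (i : ℕ) : (Prog.var i).PolyTime := by
  refine ⟨Polynomial.X + 2, fun B O hO env o ho => ?_⟩
  simp only [eval, mem_support_emit] at ho
  subst ho
  have := size_getD_le env i
  simp at this ⊢; omega

theorem PolyTime.nil : Prog.nil.PolyTime := by
  refine ⟨2, fun B O hO env o ho => ?_⟩
  simp only [eval, mem_support_emit] at ho
  subst ho
  simp [Data.size]

theorem PolyTime.coin : Prog.coin.PolyTime := by
  refine ⟨4, fun B O hO env o ho => ?_⟩
  simp only [eval, PMF.mem_support_bind_iff, mem_support_emit] at ho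
  obtain ⟨b, -, rfl⟩ := ho
  cases b <;> simp [Data.size, Data.ofBool]

theorem PolyTime.pair (hp : p.PolyTime) (hq : q.PolyTime) : (Prog.pair p q).PolyTime := by
  obtain ⟨s, hs⟩ := hp
  obtain ⟨t, ht⟩ := hq
  -- Each argument counts twice: for its own time, and for its contribution to the size of the
  -- result.
  refine ⟨2 * s + 2 * t + 2, fun B O hO env o ho => ?_⟩
  simp only [eval, PMF.mem_support_bind_iff, mem_support_emit] at ho
  obtain ⟨a, ha, b, hb, rfl⟩ := ho
  have h1 := hs B O hO env a ha
  have h2 := ht B O hO env b hb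
  have h3 := size_le_time ha
  have h4 := size_le_time hb
  simp [Data.size] at h1 h2 ⊢; omega

theorem PolyTime.fst (hp : p.PolyTime) : (Prog.fst p).PolyTime := by
  obtain ⟨s, hs⟩ := hp
  refine ⟨2 * s + 1, fun B O hO env o ho => ?_⟩
  simp only [eval, PMF.mem_support_bind_iff, mem_support_emit] at ho
  obtain ⟨a, ha, rfl⟩ := ho
  have h1 := hs B O hO env a ha
  have h3 := size_le_time ha
  have := a.1.size_fst_le
  simp at h1 ⊢; omega

theorem PolyTime.snd (hp : p.PolyTime) : (Prog.snd p).PolyTime := by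
  obtain ⟨s, hs⟩ := hp
  refine ⟨2 * s + 1, fun B O hO env o ho => ?_⟩
  simp only [eval, PMF.mem_support_bind_iff, mem_support_emit] at ho
  obtain ⟨a, ha, rfl⟩ := ho
  have h1 := hs B O hO env a ha
  have h3 := size_le_time ha
  have := a.1.size_snd_le
  simp at h1 ⊢; omega

theorem PolyTime.query (hp : p.PolyTime) : (Prog.query p).PolyTime := by
  obtain ⟨s, hs⟩ := hp
  refine ⟨s + Polynomial.X + 1, fun B O hO env o ho => ?_⟩
  simp only [eval, PMF.mem_support_bind_iff, mem_support_emit] at ho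
  obtain ⟨a, ha, rfl⟩ := ho
  have h1 := hs B O hO env a ha
  have := hO a.1
  simp at h1 ⊢; omega

theorem PolyTime.cond (hp : p.PolyTime) (hq : q.PolyTime) (hr : r.PolyTime) :
    (Prog.cond p q r).PolyTime := by
  obtain ⟨s, hs⟩ := hp
  obtain ⟨t, ht⟩ := hq
  obtain ⟨t', ht'⟩ := hr
  refine ⟨s + 2 * t + 2 * t' + 1, fun B O hO env o ho => ?_⟩
  simp only [eval, PMF.mem_support_bind_iff] at ho
  obtain ⟨a, ha, ho⟩ := ho
  have h1 := hs B O hO env a ha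
  split at ho <;> simp only [PMF.mem_support_bind_iff, mem_support_emit] at ho <;>
    obtain ⟨b, hb, rfl⟩ := ho <;> have h4 := size_le_time hb
  · have h2 := ht' B O hO env b hb
    simp at h1 h2 ⊢; omega
  · have h2 := ht B O hO env b hb
    simp at h1 h2 ⊢; omega

theorem PolyTime.letIn (hp : p.PolyTime) (hq : q.PolyTime) : (Prog.letIn p q).PolyTime := by
  obtain ⟨s, hs⟩ := hp
  obtain ⟨t, ht⟩ := hq
  refine ⟨s + 2 * t.comp (s + Polynomial.X) + 1, fun B O hO env o ho => ?_⟩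
  simp only [eval, PMF.mem_support_bind_iff, mem_support_emit] at ho
  obtain ⟨a, ha, b, hb, rfl⟩ := ho
  have h1 := hs B O hO env a ha
  have h2 := ht B O hO _ b hb
  have h3 := size_le_time ha
  have h4 := size_le_time hb
  have h5 : t.eval (envSize (a.1 :: env) + B) ≤ t.eval (s.eval (envSize env + B) + (envSize env + B)) :=
    eval_mono t (by simp; omega)
  simp at h1 h2 h5 ⊢; omega

/-- The called program sees an environment with one entry, so `PolyTimeOn` suffices. This is all
that is known about an arbitrary PPT algorithm, such as the evaluator of the PRP or a distinguisher.
-/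
theorem PolyTime.call (hq : q.PolyTimeOn) (hp : p.PolyTime) : (Prog.call q p).PolyTime := by
  obtain ⟨s, hs⟩ := hp
  obtain ⟨t, ht⟩ := hq
  refine ⟨s + 2 * t.comp (s + Polynomial.X) + 1, fun B O hO env o ho => ?_⟩
  simp only [eval, PMF.mem_support_bind_iff, mem_support_emit] at ho
  obtain ⟨a, ha, b, hb, rfl⟩ := ho
  have h1 := hs B O hO env a ha
  have h2 := ht B O hO _ b hb
  have h3 := size_le_time ha
  have h4 := size_le_time hb
  have h5 : t.eval (a.1.size + B) ≤ t.eval (s.eval (envSize env + B) + (envSize env + B)) :=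
    eval_mono t (by omega)
  simp at h1 h2 h5 ⊢; omega

/-- The size of the value is polynomial in the size of the environment without its `k`-th entry. -/
def PolySizeOff (k : ℕ) (P : Prog) : Prop := ∃ g : Polynomial ℕ, ∀ (B : ℕ) (O : Data → Data),
  (∀ d, (O d).size ≤ B) → ∀ env, ∀ o ∈ (P.eval O env).support,
    o.1.size ≤ g.eval (envSize (env.eraseIdx k) + B)

/-- The size of the value exceeds the size of the `k`-th entry of the environment by at most a
polynomial in the size of the other entries. -/
def Grows (k : ℕ) (P : Prog) : Prop := ∃ g : Polynomial ℕ, ∀ (B : ℕ) (O : Data → Data),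
  (∀ d, (O d).size ≤ B) → ∀ env, ∀ o ∈ (P.eval O env).support,
    o.1.size ≤ (env.getD k Data.nil).size + g.eval (envSize (env.eraseIdx k) + B)

/-- `G` bounds the growth of the accumulator in one round. It keeps all intermediate values below
`M`, so every round can be charged the cost `R` that is valid for accumulators of size at most `M`.
-/
theorem _root_.GPSI.foldTime_bound {f : Data → Data → PMF (Data × ℕ)} {G R M : ℕ} {l : List Data}
    (hG : ∀ x ∈ l, ∀ a, ∀ o ∈ (f x a).support, o.1.size ≤ a.size + G)
    (hR : ∀ x ∈ l, ∀ a, a.size ≤ M → ∀ o ∈ (f x a).support, o.2 ≤ R) {a : Data} {c : ℕ}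
    (hM : a.size + l.length * G ≤ M) :
    ∀ o ∈ (foldTime f l a c).support, o.1.size ≤ M ∧ o.2 ≤ c + l.length * R := by
  induction l generalizing a c with
  | nil =>
    intro o ho
    rw [foldTime, PMF.mem_support_pure_iff] at ho
    subst ho
    simpa using hM
  | cons x xs ih =>
    intro o ho
    rw [foldTime, PMF.mem_support_bind_iff] at ho
    obtain ⟨y, hy, ho⟩ := ho
    have h1 := hG x (by simp) a y hy
    simp only [List.length_cons, add_mul, one_mul] at hM ⊢
    have h2 := hR x (by simp) a (by omega) y hy
    have h3 := ih (fun x hx => hG x (List.mem_cons_of_mem _ hx))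
      (fun x hx => hR x (List.mem_cons_of_mem _ hx)) (a := y.1) (c := c + y.2) (by omega) o ho
    omega

/-- A polynomial-time body alone would not do, since doubling the accumulator in each round gives
exponential size. The index `1` in `Grows` is the position of the accumulator in the body's
environment. -/
theorem PolyTime.fold (hp : p.PolyTime) (hq : q.PolyTime) (hr : r.PolyTime) (hg : r.Grows 1) :
    (Prog.fold p q r).PolyTime := by
  obtain ⟨s, hs⟩ := hp
  obtain ⟨t, ht⟩ := hq
  obtain ⟨w, hw⟩ := hr
  obtain ⟨g, hg⟩ := hg
  -- `s` bounds both the number of rounds and the size of an entry. The term `t + s * g.comp (s +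
  -- X)` bounds the accumulator throughout; it enters the argument of `w`, and once more the charge
  -- for the final result.
  refine ⟨s + t + s * w.comp (s + (t + s * g.comp (s + Polynomial.X)) + Polynomial.X) +
    (t + s * g.comp (s + Polynomial.X)) + 1, fun B O hO env o ho => ?_⟩
  simp only [eval, PMF.mem_support_bind_iff, mem_support_emit] at ho
  obtain ⟨l, hl, a, ha, b, hb, rfl⟩ := ho
  have h1 := hs B O hO env l hl
  have h2 := ht B O hO env a ha
  have h3 := size_le_time hl
  have h4 := size_le_time ha
  simp only [Polynomial.eval_add, Polynomial.eval_mul, Polynomial.eval_comp, Polynomial.eval_X,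
    Polynomial.eval_one]
  set N := envSize env + B with hN
  set G := g.eval (s.eval N + N) with hGdef
  set M := t.eval N + s.eval N * G with hMdef
  have hlen : l.1.toList.length ≤ s.eval N := by have := l.1.length_toList_lt; omega
  have hmem : ∀ x ∈ l.1.toList, x.size ≤ s.eval N := fun x hx => by
    have := Data.size_lt_of_mem hx; omega
  have key := foldTime_bound (l := l.1.toList) (G := G) (R := w.eval (s.eval N + M + N)) (M := M)
    (f := fun x y => r.eval O (x :: y :: env)) ?_ ?_ (a := a.1) (c := l.2 + a.2) ?_ b hb
  · have := Nat.mul_le_mul_right (w.eval (s.eval N + M + N)) hlen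
    omega
  · intro x hx y o ho
    have h5 := hg B O hO _ o ho
    have h6 : g.eval (envSize ((x :: y :: env).eraseIdx 1) + B) ≤ G :=
      eval_mono g (by have := hmem x hx; simp; omega)
    simp at h5 h6 ⊢; omega
  · intro x hx y hy o ho
    refine (hw B O hO _ o ho).trans (eval_mono w ?_)
    have := hmem x hx; simp; omega
  · have := Nat.mul_le_mul_right G hlen
    omega

theorem _root_.GPSI.size_getD_le_eraseIdx (env : List Data) {i k : ℕ} (h : i ≠ k) :
    (env.getD i Data.nil).size ≤ envSize (env.eraseIdx k) + 1 := by
  induction env generalizing i k with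
  | nil => simp [Data.size]
  | cons d env ih =>
    cases k with
    | zero =>
      obtain ⟨i, rfl⟩ := Nat.exists_eq_succ_of_ne_zero h
      simpa using size_getD_le env i
    | succ k =>
      cases i with
      | zero => simp; omega
      | succ i => have := ih (i := i) (k := k) (by omega); simp at this ⊢; omega

variable {k : ℕ}

theorem PolySizeOff.var {i : ℕ} (h : i ≠ k) : (Prog.var i).PolySizeOff k := by
  refine ⟨Polynomial.X + 1, fun B O hO env o ho => ?_⟩
  simp only [eval, mem_support_emit] at ho
  subst ho
  have := size_getD_le_eraseIdx env h
  simp at this ⊢; omega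

theorem PolySizeOff.nil : Prog.nil.PolySizeOff k := by
  refine ⟨1, fun B O hO env o ho => ?_⟩
  simp only [eval, mem_support_emit] at ho
  subst ho
  simp [Data.size]

theorem PolySizeOff.coin : Prog.coin.PolySizeOff k := by
  refine ⟨3, fun B O hO env o ho => ?_⟩
  simp only [eval, PMF.mem_support_bind_iff, mem_support_emit] at ho
  obtain ⟨b, -, rfl⟩ := ho
  cases b <;> simp [Data.size, Data.ofBool]

theorem PolySizeOff.pair (hp : p.PolySizeOff k) (hq : q.PolySizeOff k) :
    (Prog.pair p q).PolySizeOff k := by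
  obtain ⟨s, hs⟩ := hp
  obtain ⟨t, ht⟩ := hq
  refine ⟨s + t + 1, fun B O hO env o ho => ?_⟩
  simp only [eval, PMF.mem_support_bind_iff, mem_support_emit] at ho
  obtain ⟨a, ha, b, hb, rfl⟩ := ho
  have h1 := hs B O hO env a ha
  have h2 := ht B O hO env b hb
  simp [Data.size] at h1 h2 ⊢; omega

theorem PolySizeOff.fst (hp : p.PolySizeOff k) : (Prog.fst p).PolySizeOff k := by
  obtain ⟨s, hs⟩ := hp
  refine ⟨s, fun B O hO env o ho => ?_⟩
  simp only [eval, PMF.mem_support_bind_iff, mem_support_emit] at ho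
  obtain ⟨a, ha, rfl⟩ := ho
  exact (a.1.size_fst_le).trans (hs B O hO env a ha)

theorem PolySizeOff.snd (hp : p.PolySizeOff k) : (Prog.snd p).PolySizeOff k := by
  obtain ⟨s, hs⟩ := hp
  refine ⟨s, fun B O hO env o ho => ?_⟩
  simp only [eval, PMF.mem_support_bind_iff, mem_support_emit] at ho
  obtain ⟨a, ha, rfl⟩ := ho
  exact (a.1.size_snd_le).trans (hs B O hO env a ha)

/-- Nothing is required of the argument: the answer has size at most `B` whatever is asked. -/
theorem PolySizeOff.query : (Prog.query p).PolySizeOff k := by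
  refine ⟨Polynomial.X, fun B O hO env o ho => ?_⟩
  simp only [eval, PMF.mem_support_bind_iff, mem_support_emit] at ho
  obtain ⟨a, ha, rfl⟩ := ho
  have := hO a.1
  simp; omega

theorem PolySizeOff.call (hq : q.PolyTimeOn) (hp : p.PolySizeOff k) :
    (Prog.call q p).PolySizeOff k := by
  obtain ⟨s, hs⟩ := hp
  obtain ⟨t, ht⟩ := hq
  refine ⟨t.comp (s + Polynomial.X), fun B O hO env o ho => ?_⟩
  simp only [eval, PMF.mem_support_bind_iff, mem_support_emit] at ho
  obtain ⟨a, ha, b, hb, rfl⟩ := ho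
  have h1 := hs B O hO env a ha
  have h2 := ht B O hO _ b hb
  have h4 := size_le_time hb
  rw [Polynomial.eval_comp]
  exact (h4.trans h2).trans (eval_mono t (by simp; omega))

theorem Grows.var : (Prog.var k).Grows k := by
  refine ⟨0, fun B O hO env o ho => ?_⟩
  simp only [eval, mem_support_emit] at ho
  subst ho
  simp

theorem Grows.snd (hp : p.Grows k) : (Prog.snd p).Grows k := by
  obtain ⟨s, hs⟩ := hp
  refine ⟨s, fun B O hO env o ho => ?_⟩
  simp only [eval, PMF.mem_support_bind_iff, mem_support_emit] at ho
  obtain ⟨a, ha, rfl⟩ := ho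
  exact (a.1.size_snd_le).trans (hs B O hO env a ha)

theorem Grows.pair (hp : p.PolySizeOff k) (hq : q.Grows k) : (Prog.pair p q).Grows k := by
  obtain ⟨s, hs⟩ := hp
  obtain ⟨t, ht⟩ := hq
  refine ⟨s + t + 1, fun B O hO env o ho => ?_⟩
  simp only [eval, PMF.mem_support_bind_iff, mem_support_emit] at ho
  obtain ⟨a, ha, b, hb, rfl⟩ := ho
  have h1 := hs B O hO env a ha
  have h2 := ht B O hO env b hb
  simp [Data.size] at h1 h2 ⊢; omega

theorem Det.fst_eq (h : p.Det) {O : Data → Data} {env : List Data} {o : Data × ℕ}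
    (ho : o ∈ (p.eval O env).support) : o.1 = p.detVal env := by
  have h1 : o.1 ∈ (p.val O env).support := by
    rw [val, PMF.support_map]
    exact ⟨o, ho, rfl⟩
  rw [h.val_eq] at h1
  simpa using h1

/-- For deterministic bodies the growth can be checked on `detVal`, which permits a case distinction
over branches that treat the accumulator differently. -/
theorem Det.grows (h : p.Det) (g : Polynomial ℕ)
    (hg : ∀ env, (p.detVal env).size ≤
      (env.getD k Data.nil).size + g.eval (envSize (env.eraseIdx k))) : p.Grows k := by
  refine ⟨g, fun B O hO env o ho => ?_⟩
  rw [h.fst_eq ho]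
  exact (hg env).trans (Nat.add_le_add_left (eval_mono g (Nat.le_add_right _ _)) _)

end Prog

end GPSI

namespace GPSI

open Prog

/-! ## Deterministic programs for lists and bit strings -/

namespace Data

@[simp] theorem fst_nil : nil.fst = nil := rfl
@[simp] theorem snd_nil : nil.snd = nil := rfl
@[simp] theorem fst_node (a b : Data) : (node a b).fst = a := rfl
@[simp] theorem snd_node (a b : Data) : (node a b).snd = b := rfl
@[simp] theorem ite_nil {α : Type*} (x y : α) : nil.ite x y = y := rfl
@[simp] theorem ite_node {α : Type*} (a b : Data) (x y : α) : (node a b).ite x y = x := rfl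

theorem ofList_toList (d : Data) : ofList d.toList = d := by
  induction d with
  | nil => rfl
  | node a b _ ih => simp [toList, ofList, ih]

theorem size_ofList (l : List Data) : (ofList l).size = (l.map fun x => x.size + 1).sum + 1 := by
  rw [size_eq, toList_ofList]

theorem ofBits_cons {n : ℕ} (b : Bool) (x : BitVec n) :
    ofBits (BitVec.cons b x) = node (ofBool b) (ofBits x) := by
  simp [ofBits, ofList, List.ofFn_succ]

/-- The outcome of a comparison with a larger string (equality is reported as `nil`). -/
def lt : Data := node nil nil

/-- The outcome of a comparison with a smaller string. -/
def gt : Data := node lt nil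

end Data

/-- Prepends the reverse of a list to a list. -/
def Prog.revOnto (p q : Prog) : Prog := fold p q (pair (var 0) (var 1))

theorem foldl_node (l : List Data) (a : Data) :
    l.foldl (fun a x => Data.node x a) a = Data.ofList (l.reverse ++ a.toList) := by
  induction l generalizing a with
  | nil => simp [Data.ofList_toList]
  | cons x xs ih => simp [ih, Data.toList]

theorem Prog.revOnto_detVal (p q : Prog) (env : List Data) : (revOnto p q).detVal env =
    Data.ofList ((p.detVal env).toList.reverse ++ (q.detVal env).toList) := by
  simp [revOnto, detVal, foldl_node]

theorem Prog.PolyTime.revOnto {p q : Prog} (hp : p.PolyTime) (hq : q.PolyTime) :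
    (revOnto p q).PolyTime :=
  hp.fold hq (.pair (.var 0) (.var 1)) (.pair (.var (by decide)) .var)

/-! ### Comparison -/

/-- One step of the comparison: the state holds the rest of the second string and the outcome so
far. -/
def cmpStep : Prog :=
  cond (snd (var 1)) (var 1)
    (pair (snd (fst (var 1)))
      (cond (var 0)
        (cond (fst (fst (var 1))) nil (pair (pair nil nil) nil))
        (cond (fst (fst (var 1))) (pair nil nil) nil)))

/-- Compares the components of a pair of bit strings. -/
def cmpProg : Prog := snd (fold (fst (var 0)) (pair (snd (var 0)) nil) cmpStep)

theorem cmpProg_det : cmpProg.Det := by simp [cmpProg, cmpStep, Det]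

theorem cmpProg_polyTime : cmpProg.PolyTime := by
  have v := PolyTime.var
  have n := PolyTime.nil
  refine .snd (.fold (v 0).fst ((v 0).snd.pair n) ?_ ?_)
  · exact .cond (v 1).snd (v 1) (.pair (v 1).fst.snd (.cond (v 0)
      (.cond (v 1).fst.fst n (.pair (n.pair n) n)) (.cond (v 1).fst.fst (n.pair n) n)))
  -- The second string only loses bits, and an outcome has size at most `5`. The constant `6` is
  -- attained at the accumulator `nil`, which can become `(nil, gt)`, of size `7`.
  · refine Det.grows (by simp [cmpStep, Det]) 6 fun env => ?_
    simp only [cmpStep, detVal]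
    generalize env.getD 1 Data.nil = a
    generalize env.getD 0 Data.nil = x
    rcases a with _ | ⟨a1, a2⟩
    · cases x <;> simp [Data.size]
    · have h := a1.size_snd_le
      have h2 := a2.size_pos
      simp only [Data.fst_node, Data.snd_node]
      generalize a1.snd = b at *
      generalize a1.fst = c
      cases a2 <;> cases x <;> cases c <;> simp [Data.size] at * <;> omega

theorem cmpStep_undecided (x c y : Data) (env : List Data) :
    cmpStep.detVal (x :: Data.node (Data.node c y) Data.nil :: env) =
      Data.node y (x.ite (c.ite Data.nil Data.gt) (c.ite Data.lt Data.nil)) := rfl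

theorem foldl_cmpStep_decided (l : List Data) (env : List Data) (a b c : Data) :
    l.foldl (fun a x => cmpStep.detVal (x :: a :: env)) (Data.node a (Data.node b c)) =
      Data.node a (Data.node b c) := by
  induction l with
  | nil => rfl
  | cons x xs ih => simpa [cmpStep, detVal] using ih

/-- Bits come most significant first, so lexicographic and numerical order agree. The first
differing bit decides, later rounds keep that outcome (`foldl_cmpStep_decided`), and equal leading
bits reduce to shorter strings. -/
theorem foldl_cmpStep {n : ℕ} (x y : BitVec n) (env : List Data) :
    ((Data.ofBits x).toList.foldl (fun a x => cmpStep.detVal (x :: a :: env))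
      (Data.node (Data.ofBits y) Data.nil)).snd =
        if x < y then Data.lt else if y < x then Data.gt else Data.nil := by
  induction n with
  | zero =>
    have e : x = y := Subsingleton.elim _ _
    subst e
    simp [Data.ofBits, Data.ofList, Data.toList, BitVec.lt_irrefl]
  | succ n ih =>
    rw [← BitVec.cons_msb_setWidth x, ← BitVec.cons_msb_setWidth y]
    generalize x.msb = b
    generalize y.msb = c
    generalize x.setWidth n = x'
    generalize y.setWidth n = y'
    have hx := x'.isLt
    have hy := y'.isLt
    simp only [Data.ofBits_cons, Data.toList, List.foldl_cons, BitVec.lt_def, BitVec.toNat_cons']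
    cases b <;> cases c
    · simpa [cmpStep_undecided, Data.ofBool, BitVec.lt_def] using
        ih x' y'
    · simp only [cmpStep_undecided, Data.ofBool, Data.ite_nil, Data.ite_node, Data.lt]
      rw [foldl_cmpStep_decided _ env, if_pos, Data.snd_node]
      simp [Nat.shiftLeft_eq]; omega
    · simp only [cmpStep_undecided, Data.ofBool, Data.ite_nil, Data.ite_node, Data.gt]
      rw [foldl_cmpStep_decided _ env, if_neg, if_pos, Data.snd_node] <;>
        simp [Nat.shiftLeft_eq] <;> omega
    · simpa [cmpStep_undecided, Data.ofBool, BitVec.lt_def] using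
        ih x' y'

theorem cmpProg_ofBits {n : ℕ} (x y : BitVec n) :
    cmpProg.detVal [Data.node (Data.ofBits x) (Data.ofBits y)] =
      if x < y then Data.lt else if y < x then Data.gt else Data.nil :=
  foldl_cmpStep x y _

/-! ### Sorting -/

/-- Distributes an entry `y` of the list in `(x, l)` to the entries below and above `x`. -/
def partStep : Prog :=
  letIn (call cmpProg (pair (var 0) (fst (var 2))))
    (cond (var 0)
      (cond (fst (var 0))
        (pair (fst (var 2)) (pair (var 1) (snd (var 2))))
        (pair (pair (var 1) (fst (var 2))) (snd (var 2))))
      (var 2))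

/-- Inserts `x` into the strictly increasing list `l`, on the input `(x, l)`. -/
def insertProg : Prog :=
  letIn (fold (snd (var 0)) (pair nil nil) partStep)
    (revOnto (fst (var 0)) (pair (fst (var 1)) (revOnto (snd (var 0)) nil)))

/-- Sorts a list of bit strings and removes repetitions. -/
def sortProg : Prog := fold (var 0) nil (call insertProg (pair (var 0) (var 1)))

/-- The comparison program says that `y` is below `x`. -/
def isLow (x y : Data) : Bool :=
  (cmpProg.detVal [Data.node y x]).ite
    ((cmpProg.detVal [Data.node y x]).fst.ite false true) false

/-- The comparison program says that `y` is above `x`. -/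
def isHigh (x y : Data) : Bool :=
  (cmpProg.detVal [Data.node y x]).ite
    ((cmpProg.detVal [Data.node y x]).fst.ite true false) false

theorem partStep_detVal (x l y a b : Data) :
    partStep.detVal [y, Data.node a b, Data.node x l] =
      Data.node (if isLow x y then Data.node y a else a) (if isHigh x y then Data.node y b else b) := by
  rcases h : cmpProg.detVal [Data.node y x] with _ | ⟨_ | _, _⟩ <;>
    simp [partStep, detVal, isLow, isHigh, h]

theorem foldl_partStep (x l : Data) (ys : List Data) (a b : Data) :
    ys.foldl (fun a y => partStep.detVal [y, a, Data.node x l]) (Data.node a b) =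
      Data.node (Data.ofList ((ys.filter (isLow x)).reverse ++ a.toList))
        (Data.ofList ((ys.filter (isHigh x)).reverse ++ b.toList)) := by
  induction ys generalizing a b with
  | nil => simp [Data.ofList_toList]
  | cons y ys ih =>
    rw [List.foldl_cons, partStep_detVal, ih]
    cases h1 : isLow x y <;> cases h2 : isHigh x y <;> simp [h1, h2, Data.toList]

/-- The fold collects both parts in reverse, and `revOnto` restores their order. The formula covers
arbitrary trees, because the time bound must hold for inputs that encode no bit strings as well. -/
theorem insertProg_detVal (x l : Data) : insertProg.detVal [Data.node x l] =
    Data.ofList (l.toList.filter (isLow x) ++ x :: l.toList.filter (isHigh x)) := by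
  simp only [insertProg, detVal, revOnto_detVal, List.getD_cons_zero, List.getD_cons_succ,
    foldl_partStep, Data.fst_node, Data.snd_node]
  simp [Data.toList, Data.toList_ofList]

/-- `isLow` and `isHigh` read the same comparison outcome and exclude each other, so no entry is
copied twice. Insertion thus grows the list additively, as the iteration in `sortProg` requires. -/
theorem insertProg_size (x l : Data) :
    (insertProg.detVal [Data.node x l]).size ≤ l.size + (x.size + 1) := by
  rw [insertProg_detVal, Data.size_ofList, Data.size_eq l]
  generalize l.toList = ys
  simp only [List.map_append, List.map_cons, List.sum_append, List.sum_cons]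
  suffices h : ((ys.filter (isLow x)).map fun x => x.size + 1).sum +
      ((ys.filter (isHigh x)).map fun x => x.size + 1).sum ≤ (ys.map fun x => x.size + 1).sum by
    omega
  induction ys with
  | nil => simp
  | cons y ys ih =>
    have h : isLow x y = false ∨ isHigh x y = false := by
      simp only [isLow, isHigh]
      generalize cmpProg.detVal [Data.node y x] = c
      rcases c with _ | ⟨_ | _, _⟩ <;> simp
    rcases h with h | h
    · cases h2 : isHigh x y <;> simp only [h, h2, List.filter_cons, List.map_cons, List.sum_cons, if_true, Bool.false_eq_true,
        if_false] <;> omega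
    · cases h2 : isLow x y <;> simp only [h, h2, List.filter_cons, List.map_cons, List.sum_cons, if_true, Bool.false_eq_true,
        if_false] <;> omega

theorem partStep_det : partStep.Det := by simp [partStep, Det, cmpProg_det]

theorem insertProg_det : insertProg.Det := by simp [insertProg, Det, partStep_det, revOnto]

theorem sortProg_det : sortProg.Det := by simp [sortProg, Det, insertProg_det]

theorem partStep_polyTime : partStep.PolyTime := by
  have v := PolyTime.var
  exact .letIn (.call cmpProg_polyTime.on ((v 0).pair (v 2).fst)) (.cond (v 0) (.cond (v 0).fst
    (.pair (v 2).fst (.pair (v 1) (v 2).snd)) (.pair (.pair (v 1) (v 2).fst) (v 2).snd)) (v 2))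

theorem partStep_grows : partStep.Grows 1 := by
  refine Det.grows partStep_det (Polynomial.X + 4) fun env => ?_
  have h0 := size_getD_le_eraseIdx env (i := 0) (k := 1) (by decide)
  simp only [partStep, detVal, List.getD_cons_zero, List.getD_cons_succ]
  generalize cmpProg.detVal _ = c
  generalize env.getD 1 Data.nil = a at *
  generalize env.getD 0 Data.nil = y at *
  simp only [Polynomial.eval_add, Polynomial.eval_X, Polynomial.eval_ofNat]
  rcases c with _ | ⟨_ | _, _⟩ <;> cases a <;> simp [Data.size] <;>
    omega

theorem insertProg_polyTime : insertProg.PolyTime := by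
  have v := PolyTime.var
  exact .letIn (.fold (v 0).snd (.pair .nil .nil) partStep_polyTime partStep_grows)
    (.revOnto (v 0).fst (.pair (v 1).fst (.revOnto (v 0).snd .nil)))

theorem sortProg_polyTime : sortProg.PolyTime := by
  have v := PolyTime.var
  refine .fold (v 0) .nil (.call insertProg_polyTime.on ((v 0).pair (v 1))) ?_
  refine Det.grows (by simp [Det, insertProg_det]) (Polynomial.X + 2) fun env => ?_
  have h0 := size_getD_le_eraseIdx env (i := 0) (k := 1) (by decide)
  simp only [detVal]
  refine (insertProg_size _ _).trans ?_
  simp only [Polynomial.eval_add, Polynomial.eval_X, Polynomial.eval_ofNat]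
  omega

/-! ### Correctness of comparison, insertion and sorting on encoded bit strings -/

section Sorting

variable {u : ℕ}

theorem isLow_ofBits (x y : BitVec u) : isLow (Data.ofBits x) (Data.ofBits y) = decide (y < x) := by
  rw [isLow, cmpProg_ofBits]
  split_ifs with h1 h2 <;> simp [Data.lt, Data.gt, h1]

theorem isHigh_ofBits (x y : BitVec u) :
    isHigh (Data.ofBits x) (Data.ofBits y) = decide (x < y) := by
  rw [isHigh, cmpProg_ofBits]
  split_ifs with h1 h2
  · simpa [Data.lt] using BitVec.le_of_lt h1
  · simp [Data.lt, Data.gt, h2]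
  · simp [h2]

theorem pairwise_lt_sort (s : Finset (BitVec u)) : (s.sort (· ≤ ·)).Pairwise (· < ·) := by
  refine ((s.pairwise_sort (· ≤ ·)).and (s.sort_nodup (· ≤ ·))).imp fun {a b} h => ?_
  exact BitVec.lt_of_le_ne h.1 h.2

/-- Both sides are strictly increasing and have the same members, which determines a list. -/
theorem sort_insert_eq (x : BitVec u) (s : Finset (BitVec u)) :
    (insert x s).sort (· ≤ ·) = (s.sort (· ≤ ·)).filter (fun y => y < x) ++
      x :: (s.sort (· ≤ ·)).filter (fun y => x < y) := by
  refine List.Pairwise.eq_of_mem_iff (pairwise_lt_sort _) ?_ fun y => ?_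
  · have h := pairwise_lt_sort s
    rw [List.pairwise_append, List.pairwise_cons]
    refine ⟨h.filter _, ⟨fun y hy => by simpa using (List.mem_filter.1 hy).2, h.filter _⟩, ?_⟩
    intro a ha b hb
    have ha := (List.mem_filter.1 ha).2
    rcases List.mem_cons.1 hb with rfl | hb
    · simpa using ha
    · have hb := (List.mem_filter.1 hb).2
      simp only [decide_eq_true_eq] at ha hb
      exact BitVec.lt_trans ha hb
  · simp only [Finset.mem_sort, Finset.mem_insert, List.mem_append, List.mem_cons, List.mem_filter,
      decide_eq_true_eq]
    constructor
    · rintro (h | h)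
      · exact Or.inr (Or.inl h)
      · by_cases h1 : y < x
        · exact Or.inl ⟨h, h1⟩
        · by_cases h2 : x < y
          · exact Or.inr (Or.inr ⟨h, h2⟩)
          · exact Or.inr (Or.inl (BitVec.le_antisymm (BitVec.not_lt.1 h2) (BitVec.not_lt.1 h1)))
    · rintro (h | h | h)
      exacts [Or.inr h.1, Or.inl h, Or.inr h.1]

theorem insertProg_ofFinset (x : BitVec u) (s : Finset (BitVec u)) :
    insertProg.detVal [Data.node (Data.ofBits x) (Data.ofFinset s)] =
      Data.ofFinset (insert x s) := by
  rw [insertProg_detVal, Data.ofFinset, Data.ofFinset, sort_insert_eq, Data.toList_ofList]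
  simp [List.filter_map, Function.comp_def, isLow_ofBits, isHigh_ofBits]

/-- The result depends only on the set of entries. Programs may therefore produce ciphertexts in any
order and with repetitions. -/
theorem sortProg_ofList (l : List (BitVec u)) :
    sortProg.detVal [Data.ofList (l.map Data.ofBits)] = Data.ofFinset l.toFinset := by
  suffices h : ∀ (s : Finset (BitVec u)) (env : List Data), (l.map Data.ofBits).foldl
      (fun a x => insertProg.detVal [Data.node x a]) (Data.ofFinset s) =
        Data.ofFinset (s ∪ l.toFinset) by
    have := h ∅ []
    rw [Finset.empty_union] at this
    simpa [sortProg, detVal, Data.toList_ofList, Data.ofFinset, Data.ofList] using this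
  intro s env
  induction l generalizing s with
  | nil => simp
  | cons x l ih =>
    rw [List.map_cons, List.foldl_cons, insertProg_ofFinset, ih]
    congr 1
    ext y; simp

end Sorting

end GPSI

namespace GPSI

open Prog Function

/-! ## Uniform distributions -/

section Uniform

variable {A B γ : Type*} [Fintype A] [Nonempty A] [Fintype B] [Nonempty B]

theorem uniform_map_equiv (e : A ≃ B) :
    (PMF.uniformOfFintype A).map e = PMF.uniformOfFintype B := by
  ext b
  rw [PMF.map_apply, tsum_eq_single (e.symm b)]
  · simp [Fintype.card_congr e]
  · intro a ha
    rw [if_neg]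
    rintro rfl
    simp at ha

theorem uniform_bind_equiv (e : A ≃ B) (Q : B → PMF γ) :
    (PMF.uniformOfFintype B).bind Q = (PMF.uniformOfFintype A).bind fun a => Q (e a) := by
  rw [← uniform_map_equiv e, PMF.bind_map]
  rfl

theorem uniform_prod_bind (Q : A × B → PMF γ) : (PMF.uniformOfFintype (A × B)).bind Q =
    (PMF.uniformOfFintype A).bind fun a => (PMF.uniformOfFintype B).bind fun b => Q (a, b) := by
  ext c
  simp only [PMF.bind_apply, PMF.uniformOfFintype_apply, Fintype.card_prod, tsum_fintype,
    Fintype.sum_prod_type, Finset.mul_sum]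
  refine Finset.sum_congr rfl fun a _ => Finset.sum_congr rfl fun b _ => ?_
  rw [Nat.cast_mul, ENNReal.mul_inv (by simp) (by simp), mul_assoc]

theorem uniform_bind_const (q : PMF γ) : ((PMF.uniformOfFintype A).bind fun _ => q) = q :=
  PMF.bind_const _ _

/-- The counterpart of `expect_update` for distributions, by the same exchange `swapAt`. -/
theorem uniform_bind_update {ι : Type*} [Fintype ι] [DecidableEq ι] (i : ι)
    (Q : (ι → A) → PMF γ) : (PMF.uniformOfFintype (ι → A)).bind Q =
      (PMF.uniformOfFintype (ι → A)).bind fun f =>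
        (PMF.uniformOfFintype A).bind fun a => Q (update f i a) := by
  have h := uniform_bind_equiv (swapAt (A := A) i) fun p => Q p.1
  rw [uniform_prod_bind, uniform_prod_bind] at h
  simp only [uniform_bind_const] at h
  exact h

theorem uniform_bind_eval {ι : Type*} [Fintype ι] [DecidableEq ι] (i : ι) (Q : A → PMF γ) :
    ((PMF.uniformOfFintype (ι → A)).bind fun f => Q (f i)) = (PMF.uniformOfFintype A).bind Q := by
  rw [uniform_bind_update i]
  simp

theorem uniform_bind_fin_succ {k : ℕ} (Q : (Fin (k + 1) → A) → PMF γ) :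
    (PMF.uniformOfFintype (Fin (k + 1) → A)).bind Q =
      (PMF.uniformOfFintype A).bind fun a =>
        (PMF.uniformOfFintype (Fin k → A)).bind fun f => Q (Fin.cons a f) := by
  rw [uniform_bind_equiv (Fin.consEquiv fun _ => A), uniform_prod_bind]
  rfl

theorem uniform_bind_fin_zero (Q : (Fin 0 → A) → PMF γ) (f : Fin 0 → A) :
    (PMF.uniformOfFintype (Fin 0 → A)).bind Q = Q f := by
  rw [show Q = fun _ => Q f from funext fun g => by rw [Subsingleton.elim g f],
    uniform_bind_const]

/-- The values of a uniform function on a list without repetitions are independent and uniform. -/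
theorem uniform_bind_map_list {α β : Type*} [Fintype α] [DecidableEq α] [Fintype β] [Nonempty β]
    (L : List α) (hL : L.Nodup) (Q : List β → (α → β) → PMF γ)
    (hQ : ∀ b g g', (∀ x ∉ L, g x = g' x) → Q b g = Q b g') :
    ((PMF.uniformOfFintype (α → β)).bind fun g => Q (L.map g) g) =
      (PMF.uniformOfFintype (Fin L.length → β)).bind fun b =>
        (PMF.uniformOfFintype (α → β)).bind fun g => Q (List.ofFn b) g := by
  induction L generalizing Q with
  | nil =>
    refine Eq.trans ?_ (uniform_bind_fin_zero _ Fin.elim0).symm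
    simp
  | cons x L ih =>
    obtain ⟨hx, hL⟩ := List.nodup_cons.1 hL
    rw [uniform_bind_update x]
    -- As `x` does not occur in `L`, its fresh value enters only the head of the list. The
    -- dependence on the function itself is removed by `hQ`.
    have h1 : ∀ (g : α → β) y, Q ((x :: L).map (update g x y)) (update g x y) =
        Q (y :: L.map g) g := by
      intro g y
      rw [List.map_cons, update_self, List.map_congr_left (g := g) fun z hz =>
        update_of_ne (fun h : z = x => hx (h ▸ hz)) _ _]
      exact hQ _ _ _ fun z hz => update_of_ne (fun h => hz (by simp [h])) _ _
    simp only [h1]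
    rw [PMF.bind_comm, List.length_cons, uniform_bind_fin_succ]
    congr 1
    funext y
    rw [ih hL (fun b g => Q (y :: b) g) fun b g g' h => hQ _ _ _ fun z hz =>
      h z fun hz' => hz (by simp [hz'])]
    simp [List.ofFn_succ]

end Uniform

/-! ## Lists and vectors of programs -/

/-- The list of the values of programs. -/
def Prog.listP : List Prog → Prog
  | [] => nil
  | p :: ps => pair p (listP ps)

/-- The list without its first `i` entries. -/
def Prog.dropP : ℕ → Prog → Prog
  | 0, p => p
  | i + 1, p => snd (dropP i p)

/-- The `i`-th entry of a list. -/
def Prog.nthP (i : ℕ) (p : Prog) : Prog := fst (dropP i p)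

namespace Prog

theorem PolyTime.listP {ps : List Prog} (h : ∀ p ∈ ps, p.PolyTime) : (listP ps).PolyTime := by
  induction ps with
  | nil => exact .nil
  | cons p ps ih => exact .pair (h p (by simp)) (ih fun q hq => h q (by simp [hq]))

theorem PolySizeOff.listP {k : ℕ} {ps : List Prog} (h : ∀ p ∈ ps, p.PolySizeOff k) :
    (listP ps).PolySizeOff k := by
  induction ps with
  | nil => exact .nil
  | cons p ps ih => exact .pair (h p (by simp)) (ih fun q hq => h q (by simp [hq]))

theorem PolyTime.dropP {p : Prog} (h : p.PolyTime) (i : ℕ) : (dropP i p).PolyTime := by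
  induction i with
  | zero => exact h
  | succ i ih => exact ih.snd

theorem PolyTime.nthP {p : Prog} (h : p.PolyTime) (i : ℕ) : (nthP i p).PolyTime := (h.dropP i).fst

theorem PolySizeOff.dropP {k : ℕ} {p : Prog} (h : p.PolySizeOff k) (i : ℕ) :
    (dropP i p).PolySizeOff k := by
  induction i with
  | zero => exact h
  | succ i ih => exact ih.snd

theorem PolySizeOff.nthP {k : ℕ} {p : Prog} (h : p.PolySizeOff k) (i : ℕ) :
    (nthP i p).PolySizeOff k := (h.dropP i).fst

theorem oracleFree_listP {ps : List Prog} (h : ∀ p ∈ ps, p.OracleFree) : (listP ps).OracleFree := by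
  induction ps with
  | nil => trivial
  | cons p ps ih => exact ⟨h p (by simp), ih fun q hq => h q (by simp [hq])⟩

theorem det_listP {ps : List Prog} (h : ∀ p ∈ ps, p.Det) : (listP ps).Det := by
  induction ps with
  | nil => trivial
  | cons p ps ih => exact ⟨h p (by simp), ih fun q hq => h q (by simp [hq])⟩

theorem det_dropP {p : Prog} (h : p.Det) (i : ℕ) : (dropP i p).Det := by
  induction i with
  | zero => exact h
  | succ i ih => exact ih

theorem det_nthP {p : Prog} (h : p.Det) (i : ℕ) : (nthP i p).Det := det_dropP h i

theorem oracleFree_dropP {p : Prog} (h : p.OracleFree) (i : ℕ) : (dropP i p).OracleFree := by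
  induction i with
  | zero => exact h
  | succ i ih => exact ih

theorem oracleFree_nthP {p : Prog} (h : p.OracleFree) (i : ℕ) : (nthP i p).OracleFree :=
  oracleFree_dropP h i

theorem detVal_listP (ps : List Prog) (env : List Data) :
    (listP ps).detVal env = Data.ofList (ps.map fun p => p.detVal env) := by
  induction ps with
  | nil => rfl
  | cons p ps ih => simp [listP, detVal, Data.ofList, ih]

theorem detVal_dropP (i : ℕ) (p : Prog) (env : List Data) :
    (dropP i p).detVal env = Data.ofList ((p.detVal env).toList.drop i) := by
  induction i with
  | zero => simp [dropP, Data.ofList_toList]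
  | succ i ih =>
    rw [dropP, detVal, ih, ← List.tail_drop]
    cases List.drop i (p.detVal env).toList <;> rfl

theorem detVal_nthP_ofVec {m : ℕ} (i : Fin m) {p : Prog} {env : List Data} {v : Fin m → Data}
    (h : p.detVal env = Data.ofVec v) : (nthP i p).detVal env = v i := by
  rw [nthP, detVal, detVal_dropP, h, Data.ofVec, Data.toList_ofList,
    List.drop_eq_getElem_cons (by simp)]
  simp [Data.ofList]

theorem val_listP_pure {m : ℕ} {P : Fin m → Prog} {O : Data → Data} {env : List Data}
    {v : Fin m → Data} (h : ∀ i, (P i).val O env = PMF.pure (v i)) :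
    (listP (List.ofFn P)).val O env = PMF.pure (Data.ofVec v) := by
  induction m with
  | zero => exact val_nil ..
  | succ m ih =>
    rw [List.ofFn_succ, listP, val_pair, h, ih fun i => h i.succ]
    simp [Data.ofVec, Data.ofList, List.ofFn_succ]

/-- The component programs are evaluated in the same environment with fresh coins, so their values
are independent. -/
theorem val_listP_uniform {A : Type*} [Fintype A] [Nonempty A] {m : ℕ} {P : Fin m → Prog}
    {O : Data → Data} {env : List Data} {f : Fin m → A → Data}
    (h : ∀ i, (P i).val O env = (PMF.uniformOfFintype A).bind fun a => PMF.pure (f i a)) :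
    (listP (List.ofFn P)).val O env = (PMF.uniformOfFintype (Fin m → A)).bind fun a =>
      PMF.pure (Data.ofVec fun i => f i (a i)) := by
  induction m with
  | zero =>
    rw [uniform_bind_fin_zero _ Fin.elim0]
    exact val_nil ..
  | succ m ih =>
    rw [List.ofFn_succ, listP, val_pair, h, ih (fun i => h i.succ), uniform_bind_fin_succ]
    simp [Data.ofVec, Data.ofList, List.ofFn_succ]

end Prog

/-! ## Sampling -/

/-- The list `l` is only a counter: every round ignores its entry and prepends a fresh sample. -/
theorem foldVal_sample {A : Type*} [Fintype A] [Nonempty A] (f : A → Data)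
    {F : Data → Data → PMF Data}
    (hF : ∀ x y, F x y = (PMF.uniformOfFintype A).bind fun b => PMF.pure (Data.node (f b) y))
    (l : List Data) (a : Data) :
    foldVal F l a = (PMF.uniformOfFintype (Fin l.length → A)).bind fun b =>
      PMF.pure (Data.ofList (((List.ofFn b).map f).reverse ++ a.toList)) := by
  induction l generalizing a with
  | nil =>
    refine Eq.trans ?_ (uniform_bind_fin_zero _ Fin.elim0).symm
    simp [foldVal, Data.ofList_toList]
  | cons x l ih =>
    rw [foldVal, hF, PMF.bind_bind, List.length_cons, uniform_bind_fin_succ]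
    simp [ih, Data.toList, List.ofFn_succ]

/-- A uniformly random bit string whose length is the length of the input. -/
def randBits : Prog := fold (var 0) nil (pair coin (var 1))

theorem randBits_oracleFree : randBits.OracleFree := by simp [randBits, OracleFree]

theorem randBits_polyTime : randBits.PolyTime :=
  .fold (.var 0) .nil (.pair .coin (.var 1)) (.pair .coin .var)

/-- The bits of a string, least significant bit first. -/
noncomputable def bitsEquiv (u : ℕ) : (Fin u → Bool) ≃ BitVec u :=
  (Equiv.ofBijective (fun (x : BitVec u) (i : Fin u) => x.getLsbD i) (by
    rw [Fintype.bijective_iff_injective_and_card]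
    refine ⟨fun x y h => BitVec.eq_of_getLsbD_eq fun i hi => congrFun h ⟨i, hi⟩, ?_⟩
    simp [Fintype.card_congr (BitVec.equivFin (m := u)).toEquiv])).symm

/-- `randBits` prepends its coins, so the first coin becomes the last entry, the least significant
bit. This is why `bitsEquiv` counts from that end. -/
theorem ofBits_bitsEquiv {u : ℕ} (b : Fin u → Bool) :
    Data.ofBits (bitsEquiv u b) = Data.ofList ((List.ofFn b).map Data.ofBool).reverse := by
  obtain ⟨x, rfl⟩ := (bitsEquiv u).symm.surjective b
  rw [Equiv.apply_symm_apply, Data.ofBits]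
  congr 1
  refine List.ext_getElem (by simp) fun i h1 h2 => ?_
  simp at h1
  simp only [bitsEquiv, List.getElem_ofFn, BitVec.getMsbD, h1, decide_true, Bool.true_and,
    List.getElem_reverse, List.getElem_map, Equiv.symm_symm, Equiv.ofBijective_apply,
    List.length_map, List.length_ofFn]

theorem randBits_val (O : Data → Data) (d : Data) {u : ℕ} (hd : d.toList.length = u) :
    randBits.val O [d] =
      (PMF.uniformOfFintype (BitVec u)).bind fun x => PMF.pure (Data.ofBits x) := by
  subst hd
  have h0 : (var 0).val O [d] = PMF.pure d := val_var ..
  rw [randBits, val_fold, h0, val_nil, PMF.pure_bind, PMF.pure_bind,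
    foldVal_sample Data.ofBool fun x y => by simp [val_pair, val_coin, val_var],
    uniform_bind_equiv (bitsEquiv _)]
  simp [ofBits_bitsEquiv, Data.toList]

/-- Adds random bit strings to a list: their length is given by `u`, their number by `c`. -/
def Prog.samples (c a u : Prog) : Prog := fold c a (pair (call randBits u) (var 1))

theorem Prog.PolyTime.samples {c a u : Prog} (hc : c.PolyTime) (ha : a.PolyTime) (hu : u.PolyTime)
    (hu' : u.PolySizeOff 1) : (samples c a u).PolyTime :=
  .fold hc ha (.pair (.call randBits_polyTime.on hu) (.var 1))
    (.pair (.call randBits_polyTime.on hu') .var)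

theorem Prog.samples_val {c a u : Prog} {O : Data → Data} {env : List Data} {l d : Data} {w k : ℕ}
    (hc : c.val O env = PMF.pure l) (hk : l.toList.length = k) (ha : a.val O env = PMF.pure d)
    (hu : ∀ x y, ∃ z : Data, u.val O (x :: y :: env) = PMF.pure z ∧ z.toList.length = w) :
    (samples c a u).val O env =
      (PMF.uniformOfFintype (Fin k → BitVec w)).bind fun b =>
        PMF.pure (Data.ofList (((List.ofFn b).map Data.ofBits).reverse ++ d.toList)) := by
  subst hk
  rw [samples, val_fold, hc, ha, PMF.pure_bind, PMF.pure_bind]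
  refine foldVal_sample Data.ofBits (fun x y => ?_) _ _
  obtain ⟨z, hz, hw⟩ := hu x y
  simp [val_pair, val_call, val_var, hz, randBits_val O z hw]

end GPSI

namespace GPSI

open Prog Function Finset
open scoped BigOperators

/-! ## Sizes of encodings -/

theorem Data.size_ofNat (n : ℕ) : (Data.ofNat n).size = 2 * n + 1 := by
  simp [Data.ofNat, Data.size_ofList, Data.size]; ring

theorem Data.size_ofList_le {l : List Data} {c : ℕ} (h : ∀ d ∈ l, d.size ≤ c) :
    (Data.ofList l).size ≤ l.length * (c + 1) + 1 := by
  rw [Data.size_ofList]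
  have := List.sum_le_card_nsmul (l.map fun x => x.size + 1) (c + 1) (by
    intro x hx
    obtain ⟨d, hd, rfl⟩ := List.mem_map.1 hx
    exact Nat.succ_le_succ (h d hd))
  simpa using this

theorem Data.size_ofBits_le {u : ℕ} (x : BitVec u) : (Data.ofBits x).size ≤ u * 4 + 1 := by
  have := Data.size_ofList_le (l := List.ofFn fun i : Fin u => Data.ofBool (x.getMsbD i)) (c := 3)
    (by
      intro d hd
      obtain ⟨i, rfl⟩ := List.mem_ofFn.1 hd
      cases x.getMsbD i <;> simp [Data.ofBool, Data.size])
  simpa [Data.ofBits] using this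

theorem Data.size_map_ofBits_le {u : ℕ} (l : List (BitVec u)) :
    (Data.ofList (l.map Data.ofBits)).size ≤ l.length * (u * 4 + 2) + 1 := by
  have := Data.size_ofList_le (l := l.map Data.ofBits) (c := u * 4 + 1) (by
    intro d hd
    obtain ⟨x, -, rfl⟩ := List.mem_map.1 hd
    exact Data.size_ofBits_le x)
  simpa using this

/-! ## Advantages of adversaries -/

theorem permOracle_ofBits {u : ℕ} (π : Equiv.Perm (BitVec u)) (x : BitVec u) :
    permOracle π (Data.ofBits x) = Data.ofBits (π x) :=
  (Data.ofBits_injective u).extend_apply _ _ x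

theorem size_permOracle_le {u : ℕ} (π : Equiv.Perm (BitVec u)) (d : Data) :
    (permOracle π d).size ≤ u * 4 + 1 := by
  by_cases h : ∃ x : BitVec u, Data.ofBits x = d
  · obtain ⟨x, rfl⟩ := h
    rw [permOracle_ofBits]
    exact Data.size_ofBits_le _
  · rw [permOracle, extend_apply' _ _ _ h]
    simp [Data.size]

/-- The advantage of an oracle program is negligible uniformly over advice of bounded size. -/
theorem KeyedPerm.IsSecurePRP.uniform_advantage {E : KeyedPerm} (hE : E.IsSecurePRP) {A : Prog}
    (hA : A.PolyTime) {ι : ℕ → Type} [∀ n, Finite (ι n)] [∀ n, Nonempty (ι n)]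
    (advice : ∀ n, ι n → Data) {N : ℕ → ℕ} (hN : PolyBounded N)
    (hadv : ∀ n i, (advice n i).size ≤ N n) :
    ∃ δ : ℕ → ℝ, Negligible δ ∧ (∀ n, 0 ≤ δ n) ∧ ∀ n i,
      |𝔼 k : BitVec n, acceptProb (A.output (permOracle (E.perm n k))
          (Data.ofList [Data.ofNat n, Data.ofNat (E.blockLen n), advice n i])) -
        𝔼 π : Equiv.Perm (BitVec (E.blockLen n)), acceptProb (A.output (permOracle π)
          (Data.ofList [Data.ofNat n, Data.ofNat (E.blockLen n), advice n i]))| ≤ δ n := by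
  -- For each `n` a worst advice is fixed. No algorithm has to find it, since adversaries are
  -- nonuniform and only the size of the advice is restricted.
  choose i hi using fun n => Finite.exists_max fun i : ι n =>
      |𝔼 k : BitVec n, acceptProb (A.output (permOracle (E.perm n k))
          (Data.ofList [Data.ofNat n, Data.ofNat (E.blockLen n), advice n i])) -
        𝔼 π : Equiv.Perm (BitVec (E.blockLen n)), acceptProb (A.output (permOracle π)
          (Data.ofList [Data.ofNat n, Data.ofNat (E.blockLen n), advice n i]))|
  refine ⟨_, ?_, fun n => abs_nonneg _, hi⟩
  have hpoly : PolyBounded fun n => (advice n (i n)).size := hN.mono fun n => hadv n (i n)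
  have key := hE.pseudorandom A (fun n => advice n (i n)) hpoly ?_
  · simpa only [acceptProb_bind_uniform, KeyedPerm.advInput] using key
  · obtain ⟨p, hp⟩ := hA
    -- The input has size `2n + 2u + 6` plus that of the advice, and oracle answers have size at
    -- most `4u + 1`.
    have hb : PolyBounded fun n => 2 * n + 6 * E.blockLen n + N n + 7 :=
      ((((PolyBounded.const 2).mul PolyBounded.id).add
        ((PolyBounded.const 6).mul hE.blockLen_poly)).add hN).add (PolyBounded.const 7)
    obtain ⟨q, hq⟩ := PolyBounded.comp p hb
    refine ⟨q, fun n π o ho => ?_⟩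
    refine (hp _ _ (size_permOracle_le π) _ o ho).trans ((eval_mono p ?_).trans (hq n))
    have := hadv n (i n)
    simp [KeyedPerm.advInput, Data.ofList, Data.size, Data.size_ofNat]
    omega

/-- Asks for the image of the first component of the advice and compares it with the second. -/
def pointProg : Prog :=
  cond (call cmpProg (pair (query (fst (nthP 2 (var 0)))) (snd (nthP 2 (var 0))))) nil
    (pair nil nil)

theorem pointProg_polyTime : pointProg.PolyTime :=
  have v := (PolyTime.var 0).nthP 2
  .cond (.call cmpProg_polyTime.on (.pair (.query v.fst) v.snd)) .nil (.pair .nil .nil)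

theorem pointProg_val {u : ℕ} (π : Equiv.Perm (BitVec u)) (x y : BitVec u) (a b : Data) :
    pointProg.val (permOracle π)
      [Data.ofList [a, b, Data.node (Data.ofBits x) (Data.ofBits y)]] =
      PMF.pure (if π x = y then Data.node Data.nil Data.nil else Data.nil) := by
  have h1 : (nthP 2 (var 0)).detVal [Data.ofList [a, b, Data.node (Data.ofBits x)
      (Data.ofBits y)]] = Data.node (Data.ofBits x) (Data.ofBits y) := rfl
  have hd : (nthP 2 (var 0)).Det := det_nthP (p := var 0) trivial 2
  rw [pointProg, val_cond, val_call, val_pair, val_query, val_fst, val_snd, hd.val_eq]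
  simp only [PMF.pure_bind, h1, Data.fst_node, Data.snd_node, permOracle_ofBits,
    cmpProg_det.val_eq, cmpProg_ofBits, val_nil, val_pair]
  by_cases h : π x = y
  · subst h
    simp [BitVec.lt_irrefl]
  · rw [if_neg h]
    split_ifs with h1 h2
    · rfl
    · rfl
    · exact (h (BitVec.le_antisymm (BitVec.not_lt.1 h2) (BitVec.not_lt.1 h1))).elim

/-- Under a random key, a point is mapped to a given point with probability close to `2⁻ᵘ`. -/
theorem KeyedPerm.IsSecurePRP.point_bound {E : KeyedPerm} (hE : E.IsSecurePRP) :
    ∃ δ : ℕ → ℝ, Negligible δ ∧ (∀ n, 0 ≤ δ n) ∧ ∀ n (x y : BitVec (E.blockLen n)),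
      𝔼 k : BitVec n, (if E.perm n k x = y then (1 : ℝ) else 0) ≤
        (1 / 2 : ℝ) ^ E.blockLen n + δ n := by
  -- The advice ranges over all pairs of points, so that one `δ` serves every `x` and `y`.
  obtain ⟨δ, h1, h2, h3⟩ := hE.uniform_advantage pointProg_polyTime
    (ι := fun n => BitVec (E.blockLen n) × BitVec (E.blockLen n))
    (fun n p => Data.node (Data.ofBits p.1) (Data.ofBits p.2))
    (N := fun n => 8 * E.blockLen n + 3)
    (((PolyBounded.const 8).mul hE.blockLen_poly).add (PolyBounded.const 3)) fun n p => by
      have h1 := Data.size_ofBits_le p.1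
      have h2 := Data.size_ofBits_le p.2
      simp [Data.size]; omega
  refine ⟨δ, h1, h2, fun n x y => ?_⟩
  have h := h3 n (x, y)
  have e : ∀ π : Equiv.Perm (BitVec (E.blockLen n)), acceptProb (pointProg.output (permOracle π)
      (Data.ofList [Data.ofNat n, Data.ofNat (E.blockLen n),
        Data.node (Data.ofBits x) (Data.ofBits y)])) = if π x = y then (1 : ℝ) else 0 := by
    classical
    intro π
    rw [output_eq_val, pointProg_val, acceptProb_pure]
    split_ifs <;> simp_all
  simp only [e, expect_perm_apply_eq] at h
  have hc : (1 : ℝ) / Fintype.card (BitVec (E.blockLen n)) = (1 / 2 : ℝ) ^ E.blockLen n := by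
    rw [Fintype.card_congr (BitVec.equivFin (m := E.blockLen n)).toEquiv]
    simp
  rw [hc] at h
  linarith [(abs_le.1 h).2]

/-! ## Collisions of ciphertexts -/

section Collisions

variable {m n u : ℕ} (F : BitVec n → Equiv.Perm (BitVec u)) (K : Fin m → Fin m → BitVec n)
  (S : Inputs m u)

/-- All elements of the clients' sets. -/
def allElements : Finset (BitVec u) := univ.biUnion fun a : Bool × Fin m => S a.1 a.2

/-- Ciphertexts under the keys of different pairs of clients are different. -/
def NoCollision : Prop := ∀ p p' : Fin m × Fin m, ∀ e ∈ allElements S, ∀ e' ∈ allElements S,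
  F (K p.1 p.2) e = F (K p'.1 p'.2) e' → p = p'

open Classical in
-- Union bound over two distinct pairs of clients and two elements. Once all keys except that of the
-- first pair are fixed, a collision means that one uniform key maps a fixed string to a fixed
-- string.
theorem expect_collision_keys_le {q : ℝ}
    (hq : ∀ x y, 𝔼 k : BitVec n, (if F k x = y then (1 : ℝ) else 0) ≤ q) :
    𝔼 K : Fin m → Fin m → BitVec n, (if NoCollision F K S then (0 : ℝ) else 1) ≤
      (m ^ 4 * (allElements S).card ^ 2 : ℕ) * q := by
  set U := allElements S
  have hq0 : 0 ≤ q := le_trans (expect_nonneg fun k _ => by split_ifs <;> norm_num) (hq 0 0)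
  let I : Finset (((Fin m × Fin m) × (Fin m × Fin m)) × (BitVec u × BitVec u)) :=
    univ.offDiag ×ˢ (U ×ˢ U)
  let ev : (Fin m → Fin m → BitVec n) →
      ((Fin m × Fin m) × (Fin m × Fin m)) × (BitVec u × BitVec u) → ℝ := fun K t =>
    if F (K t.1.1.1 t.1.1.2) t.2.1 = F (K t.1.2.1 t.1.2.2) t.2.2 then 1 else 0
  have h1 : ∀ K : Fin m → Fin m → BitVec n, (if NoCollision F K S then (0 : ℝ) else 1) ≤
      ∑ t ∈ I, ev K t := by
    intro K
    have h0 : ∀ t ∈ I, 0 ≤ ev K t := fun t _ => by simp only [ev]; split_ifs <;> norm_num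
    split_ifs with h
    · exact sum_nonneg h0
    · simp only [NoCollision, not_forall] at h
      obtain ⟨p, p', e, he, e', he', heq, hne⟩ := h
      refine le_trans ?_ (single_le_sum h0 (show ((p, p'), (e, e')) ∈ I from ?_))
      · simp [ev, heq]
      · simp [I, hne, U, he, he']
  refine (expect_le_expect fun K _ => h1 K).trans ?_
  rw [expect_sum_comm]
  have h2 : ∀ t ∈ I, 𝔼 K : Fin m → Fin m → BitVec n, ev K t ≤ q := by
    rintro ⟨⟨p, p'⟩, e, e'⟩ ht
    have hne : p' ≠ p := by
      have : p ≠ p' := by simpa using (mem_product.1 ht).1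
      exact this.symm
    -- Uncurrying turns the key of one pair of clients into a single coordinate, which can be
    -- resampled.
    rw [← Fintype.expect_equiv (Equiv.curry (Fin m) (Fin m) (BitVec n))
      (fun K => ev (curry K) ((p, p'), (e, e'))) _ fun K => rfl, expect_update p]
    refine expect_le univ_nonempty fun K _ => ?_
    simpa [ev, curry, update_of_ne hne] using hq e (F (K p') e')
  refine (sum_le_sum h2).trans ?_
  rw [sum_const, nsmul_eq_mul]
  refine mul_le_mul_of_nonneg_right ?_ hq0
  have hI : I.card ≤ m ^ 4 * U.card ^ 2 := by
    simp only [I, card_product]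
    refine Nat.mul_le_mul ?_ (by rw [sq])
    rw [offDiag_card]
    refine (Nat.sub_le _ _).trans ?_
    simp; ring_nf; rfl
  exact_mod_cast hI

/-- The ciphertexts of the elements of the intersections. -/
def simReply (j : Bool) (i : Fin m) : Finset (BitVec u) :=
  univ.biUnion fun l => (functionality S j i l).image fun e => F (sharedKey K j i l) e

variable {F K S}

theorem mem_allElements {j : Bool} {i : Fin m} {e : BitVec u} (h : e ∈ S j i) :
    e ∈ allElements S := mem_biUnion.2 ⟨(j, i), mem_univ _, h⟩

theorem mem_encSet {j : Bool} {i : Fin m} {c : BitVec u} :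
    c ∈ encSet F K S j i ↔ ∃ l, ∃ e ∈ S j i, F (sharedKey K j i l) e = c := by
  simp [encSet]

theorem mem_simReply {j : Bool} {i : Fin m} {c : BitVec u} :
    c ∈ simReply F K S j i ↔ ∃ l, ∃ e, (e ∈ S j i ∧ e ∈ S (!j) l) ∧ F (sharedKey K j i l) e = c := by
  simp [simReply, functionality]

/-- Equal ciphertexts of two clients come from the key that they share, or from the same client. -/
theorem NoCollision.eq_of_eq (h : NoCollision F K S) {j j' : Bool} {i i' l l' : Fin m}
    {e e' : BitVec u} (he : e ∈ S j i) (he' : e' ∈ S j' i')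
    (heq : F (sharedKey K j i l) e = F (sharedKey K j' i' l') e') :
    e = e' ∧ ((j' = j ∧ i' = i ∧ l' = l) ∨ (j' = !j ∧ i' = l ∧ l' = i)) := by
  have h1 := mem_allElements he
  have h2 := mem_allElements he'
  cases j <;> cases j' <;> simp only [sharedKey] at heq
  · have := h (i, l) (i', l') e h1 e' h2 heq
    simp only [Prod.mk.injEq] at this
    obtain ⟨rfl, rfl⟩ := this
    simpa using heq
  · have := h (i, l) (l', i') e h1 e' h2 heq
    simp only [Prod.mk.injEq] at this
    obtain ⟨rfl, rfl⟩ := this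
    simpa using heq
  · have := h (l, i) (i', l') e h1 e' h2 heq
    simp only [Prod.mk.injEq] at this
    obtain ⟨rfl, rfl⟩ := this
    simpa using heq
  · have := h (l, i) (l', i') e h1 e' h2 heq
    simp only [Prod.mk.injEq] at this
    obtain ⟨rfl, rfl⟩ := this
    simpa using heq

theorem sharedKey_not (j : Bool) (i l : Fin m) : sharedKey K (!j) l i = sharedKey K j i l := by
  cases j <;> rfl

/-- By `NoCollision.eq_of_eq`, another client sending the same ciphertext must be the partner who
shares its key, and must hold the same plaintext. Conversely, both partners encrypt a common element
under their shared key. -/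
theorem NoCollision.teeReply_eq (h : NoCollision F K S) (j : Bool) (i : Fin m) :
    teeReply F K S j i = simReply F K S j i := by
  ext c
  rw [teeReply, mem_filter, mem_simReply, one_lt_card]
  constructor
  · rintro ⟨h1, a, ha, b, hb, hab⟩
    obtain ⟨l, e, he, rfl⟩ := mem_encSet.1 h1
    -- Of two distinct senders, at least one differs from the client itself.
    have : ∃ a : Bool × Fin m, F (sharedKey K j i l) e ∈ encSet F K S a.1 a.2 ∧ a ≠ (j, i) := by
      by_cases haj : a = (j, i)
      · exact ⟨b, (mem_filter.1 hb).2, fun hb' => hab (haj.trans hb'.symm)⟩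
      · exact ⟨a, (mem_filter.1 ha).2, haj⟩
    obtain ⟨⟨j', i'⟩, h2, hne⟩ := this
    obtain ⟨l', e', he', heq⟩ := mem_encSet.1 h2
    obtain ⟨rfl, h3⟩ := h.eq_of_eq he he' heq.symm
    refine ⟨l, e, ⟨he, ?_⟩, rfl⟩
    rcases h3 with ⟨rfl, rfl, -⟩ | ⟨rfl, rfl, -⟩
    · exact (hne rfl).elim
    · exact he'
  · rintro ⟨l, e, ⟨he, he'⟩, rfl⟩
    have h1 : F (sharedKey K j i l) e ∈ encSet F K S j i := mem_encSet.2 ⟨l, e, he, rfl⟩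
    have h2 : F (sharedKey K j i l) e ∈ encSet F K S (!j) l :=
      mem_encSet.2 ⟨i, e, he', by rw [sharedKey_not]⟩
    exact ⟨h1, (j, i), by simpa using h1, (!j, l), by simpa using h2, by simp⟩

/-- Two triples of one client with equal ciphertexts agree in plaintext and index, so the lookup
puts every element of the reply into the right component. -/
theorem NoCollision.clientOutput_eq (h : NoCollision F K S) (j : Bool) (i l : Fin m) :
    clientOutput F K S j i l = functionality S j i l := by
  ext e
  rw [clientOutput, h.teeReply_eq, mem_image, functionality, mem_inter]
  constructor
  · rintro ⟨⟨c, k, l'⟩, ht, rfl⟩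
    rw [mem_filter] at ht
    obtain ⟨h1, h2, h3⟩ := ht
    simp only [triples, mem_biUnion, mem_univ, true_and, mem_image, Prod.mk.injEq] at h1
    obtain ⟨l'', e, he, rfl, rfl, rfl⟩ := h1
    subst h3
    obtain ⟨l', e', ⟨h4, h5⟩, heq⟩ := mem_simReply.1 h2
    obtain ⟨rfl, h6⟩ := h.eq_of_eq he h4 heq.symm
    rcases h6 with ⟨-, -, rfl⟩ | ⟨h6, -, -⟩
    · simpa using ⟨he, h5⟩
    · simp at h6
  · rintro ⟨h1, h2⟩
    refine ⟨(F (sharedKey K j i l) e, sharedKey K j i l, l), mem_filter.2 ⟨?_, ?_, rfl⟩, by simp⟩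
    · simp only [triples, mem_biUnion, mem_univ, true_and, mem_image]
      exact ⟨l, e, h1, rfl⟩
    · exact mem_simReply.2 ⟨l, e, ⟨h1, h2⟩, rfl⟩

end Collisions

end GPSI

namespace GPSI

open Prog Function Finset
open scoped BigOperators

/-! ## The simulator of a client -/

theorem foldVal_map_pure {α : Type*} {f : Data → Data → PMF Data} {g h : α → Data} {l : List α}
    (hf : ∀ x ∈ l, ∀ y, f (g x) y = PMF.pure (Data.node (h x) y)) (a : Data) :
    foldVal f (l.map g) a = PMF.pure (Data.ofList ((l.map h).reverse ++ a.toList)) := by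
  induction l generalizing a with
  | nil => simp [foldVal, Data.ofList_toList]
  | cons x l ih =>
    rw [List.map_cons, foldVal, hf x (by simp), PMF.pure_bind,
      ih fun y hy => hf y (List.mem_cons_of_mem _ hy)]
    simp [Data.toList]

/-- Encrypts the components with the given indices: the environment consists of the keys and the
simulator's input. -/
def encAll (PE : Prog) : List ℕ → Prog
  | [] => nil
  | l :: ls => fold (nthP l (nthP 2 (var 1))) (encAll PE ls)
      (pair (call PE (listP [fst (fst (var 3)), nthP l (var 2), var 0])) (var 1))

/-- The simulator of a client of group `j`. -/
def clientSim (PE : Prog) (m : ℕ) (j : Bool) : Prog :=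
  letIn (listP (List.ofFn fun _ : Fin m => call randBits (fst (fst (var 0)))))
    (letIn (encAll PE ((List.finRange m).map Fin.val))
      (listP [nthP 1 (var 2), bif j then nil else var 1, bif j then var 1 else nil,
        call sortProg (var 0), nthP 2 (var 2)]))

theorem encAll_oracleFree {PE : Prog} (h : PE.OracleFree) (ls : List ℕ) :
    (encAll PE ls).OracleFree := by
  induction ls with
  | nil => trivial
  | cons l ls ih =>
    refine ⟨oracleFree_nthP (oracleFree_nthP (p := var 1) trivial 2) l, ih, ⟨h, ?_⟩, trivial⟩
    exact ⟨trivial, oracleFree_nthP (p := var 2) trivial l, trivial, trivial⟩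

/-- The argument of `PE` involves a key, the security parameter and a set element, but not the
accumulator. Each round thus adds one ciphertext of polynomially bounded size. -/
theorem encAll_polyTime {PE : Prog} (h : PE.PolyTimeOn) (ls : List ℕ) :
    (encAll PE ls).PolyTime := by
  induction ls with
  | nil => exact .nil
  | cons l ls ih =>
    have v := PolyTime.var
    refine .fold (((v 1).nthP 2).nthP l) ih (.pair (.call h (.listP ?_)) (v 1))
      (.pair (.call h (.listP ?_)) .var)
    · simp only [List.mem_cons, List.not_mem_nil, or_false, forall_eq_or_imp, forall_eq]
      exact ⟨(v 3).fst.fst, (v 2).nthP l, v 0⟩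
    · simp only [List.mem_cons, List.not_mem_nil, or_false, forall_eq_or_imp, forall_eq]
      exact ⟨(PolySizeOff.var (by decide)).fst.fst, (PolySizeOff.var (by decide)).nthP l,
        .var (by decide)⟩

theorem clientSim_isPPT {PE : Prog} (h : PE.IsPPT) (m : ℕ) (j : Bool) :
    (clientSim PE m j).IsPPT := by
  refine PolyTimeOn.isPPT (PolyTime.on ?_) ?_
  · have v := PolyTime.var
    refine .letIn (.listP ?_) (.letIn (encAll_polyTime h.polyTimeOn _) (.listP ?_))
    · intro p hp
      obtain ⟨_, rfl⟩ := List.mem_ofFn.1 hp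
      exact .call randBits_polyTime.on (v 0).fst.fst
    · simp only [List.mem_cons, List.not_mem_nil, or_false, forall_eq_or_imp, forall_eq]
      refine ⟨(v 2).nthP 1, ?_, ?_, .call sortProg_polyTime.on (v 0), (v 2).nthP 2⟩
      · cases j
        exacts [v 1, .nil]
      · cases j
        exacts [.nil, v 1]
  · refine ⟨oracleFree_listP ?_, encAll_oracleFree h.1 _, oracleFree_listP ?_⟩
    · intro p hp
      obtain ⟨_, rfl⟩ := List.mem_ofFn.1 hp
      exact ⟨randBits_oracleFree, trivial⟩
    · simp only [List.mem_cons, List.not_mem_nil, or_false, forall_eq_or_imp, forall_eq]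
      refine ⟨oracleFree_nthP (p := var 2) trivial 1, ?_, ?_,
        ⟨sortProg_det.oracleFree, trivial⟩, oracleFree_nthP (p := var 2) trivial 2⟩ <;>
      cases j <;> trivial

section Client

variable {E : KeyedPerm} {PE : Prog} {m n : ℕ}

/-- Only membership in `L` is recorded, because the list is sorted afterwards. -/
theorem encAll_val (hPE : ∀ (k : BitVec n) (x : BitVec (E.blockLen n)),
    PE.output noOracle (Data.ofList [Data.ofNat n, Data.ofBits k, Data.ofBits x]) =
      PMF.pure (Data.ofBits (E.perm n k x)))
    (S : Inputs m (E.blockLen n)) (j : Bool) (i : Fin m) (κ : Fin m → BitVec n)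
    (ls : List (Fin m)) :
    ∃ L : List (BitVec (E.blockLen n)),
      (encAll PE (ls.map Fin.val)).val noOracle
        [Data.ofVec fun l => Data.ofBits (κ l), clientSimInput E.blockLen n S j i] =
          PMF.pure (Data.ofList (L.map Data.ofBits)) ∧
      ∀ c, c ∈ L ↔ ∃ l ∈ ls, ∃ e ∈ functionality S j i l, E.perm n (κ l) e = c := by
  set env := [Data.ofVec fun l => Data.ofBits (κ l), clientSimInput E.blockLen n S j i] with henv
  induction ls with
  | nil => exact ⟨[], val_nil .., by simp⟩
  | cons l ls ih =>
    obtain ⟨L, hL, hmem⟩ := ih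
    have h1 : (nthP l (nthP 2 (var 1))).val noOracle env =
        PMF.pure (Data.ofFinset (functionality S j i l)) := by
      rw [Det.val_eq (det_nthP (det_nthP (p := var 1) trivial 2) l),
        detVal_nthP_ofVec (v := fun l => Data.ofFinset (functionality S j i l)) l rfl]
    have h2 : ∀ (e : BitVec (E.blockLen n)) (y : Data),
        (pair (call PE (listP [fst (fst (var 3)), nthP l (var 2), var 0])) (var 1)).val noOracle
          (Data.ofBits e :: y :: env) =
        PMF.pure (Data.node (Data.ofBits (E.perm n (κ l) e)) y) := by
      intro e y
      have hd : (listP [fst (fst (var 3)), nthP l (var 2), var 0]).Det :=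
        ⟨trivial, det_nthP (p := var 2) trivial l, trivial, trivial⟩
      have h3 : (listP [fst (fst (var 3)), nthP l (var 2), var 0]).detVal
          (Data.ofBits e :: y :: env) =
            Data.ofList [Data.ofNat n, Data.ofBits (κ l), Data.ofBits e] := by
        rw [detVal_listP, List.map_cons, List.map_cons,
          detVal_nthP_ofVec (v := fun l => Data.ofBits (κ l)) l rfl]
        rfl
      have h4 := hPE (κ l) e
      rw [output_eq_val] at h4
      rw [val_pair, val_call, hd.val_eq, PMF.pure_bind, h3, h4, PMF.pure_bind, val_var]
      simp
    refine ⟨(((functionality S j i l).sort (· ≤ ·)).map (E.perm n (κ l))).reverse ++ L, ?_, ?_⟩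
    · rw [List.map_cons, encAll, val_fold, h1, hL, PMF.pure_bind, PMF.pure_bind, Data.ofFinset,
        Data.toList_ofList, foldVal_map_pure fun e _ y => h2 e y]
      simp [Data.toList_ofList, Function.comp_def]
    · intro c
      simp [hmem]

/-- The simulated view of a client, when it shares the keys `κ`. -/
def simView (F : BitVec n → Equiv.Perm (BitVec (E.blockLen n))) (S : Inputs m (E.blockLen n))
    (j : Bool) (i : Fin m) (κ : Fin m → BitVec n) : Data :=
  Data.ofList [Data.ofFinset (S j i),
    bif j then Data.nil else Data.ofVec fun l => Data.ofBits (κ l),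
    bif j then Data.ofVec fun l => Data.ofBits (κ l) else Data.nil,
    Data.ofFinset (univ.biUnion fun l => (functionality S j i l).image (F (κ l))),
    Data.ofVec fun l => Data.ofFinset (functionality S j i l)]

theorem clientSim_output (hPE : ∀ (k : BitVec n) (x : BitVec (E.blockLen n)),
    PE.output noOracle (Data.ofList [Data.ofNat n, Data.ofBits k, Data.ofBits x]) =
      PMF.pure (Data.ofBits (E.perm n k x)))
    (S : Inputs m (E.blockLen n)) (j : Bool) (i : Fin m) :
    (clientSim PE m j).output noOracle (clientSimInput E.blockLen n S j i) =
      (PMF.uniformOfFintype (Fin m → BitVec n)).bind fun κ =>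
        PMF.pure (simView (E.perm n) S j i κ) := by
  set d := clientSimInput E.blockLen n S j i with hd
  have h1 : (listP (List.ofFn fun _ : Fin m => call randBits (fst (fst (var 0))))).val noOracle [d] =
      (PMF.uniformOfFintype (Fin m → BitVec n)).bind fun κ =>
        PMF.pure (Data.ofVec fun l => Data.ofBits (κ l)) := by
    refine val_listP_uniform (A := BitVec n) (f := fun _ => Data.ofBits) fun _ => ?_
    have hn : (fst (fst (var 0))).val noOracle [d] = PMF.pure (Data.ofNat n) :=
      Det.val_eq (P := fst (fst (var 0))) trivial _ _
    rw [val_call, hn, PMF.pure_bind]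
    exact randBits_val _ _ (by simp [Data.ofNat, Data.toList_ofList])
  rw [output_eq_val, clientSim, val_letIn, h1, PMF.bind_bind]
  congr 1
  funext κ
  obtain ⟨L, hL, hmem⟩ := encAll_val hPE S j i κ (List.finRange m)
  rw [PMF.pure_bind, val_letIn, hL, PMF.pure_bind, Det.val_eq]
  · congr 1
    have hs : L.toFinset = univ.biUnion fun l =>
        (functionality S j i l).image (E.perm n (κ l)) := by
      ext c
      simp [hmem]
    rw [detVal_listP, simView, ← hs, ← sortProg_ofList]
    cases j <;> rfl
  · refine ⟨det_nthP (p := var 2) trivial 1, ?_, ?_, ⟨sortProg_det, trivial⟩,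
      det_nthP (p := var 2) trivial 2, trivial⟩ <;> cases j <;> trivial

/-- The keys of a client are uniform and independent. -/
theorem uniform_bind_sharedKey {γ : Type*} (j : Bool) (i : Fin m)
    (Q : (Fin m → BitVec n) → PMF γ) :
    ((PMF.uniformOfFintype (Fin m → Fin m → BitVec n)).bind fun K =>
      Q fun l => sharedKey K j i l) = (PMF.uniformOfFintype (Fin m → BitVec n)).bind Q := by
  cases j
  · exact uniform_bind_eval i Q
  -- A client of group 1 holds a column of the key matrix; transposing makes it a row.
  · rw [uniform_bind_equiv (Equiv.piComm fun _ _ => BitVec n)]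
    exact uniform_bind_eval i Q

theorem NoCollision.clientViewData_eq {F : BitVec n → Equiv.Perm (BitVec (E.blockLen n))}
    {K : Fin m → Fin m → BitVec n} {S : Inputs m (E.blockLen n)} (h : NoCollision F K S)
    (j : Bool) (i : Fin m) :
    clientViewData F K S j i = simView F S j i fun l => sharedKey K j i l := by
  have h1 := h.teeReply_eq j i
  have h2 : clientOutput F K S j i = functionality S j i := funext fun l => h.clientOutput_eq j i l
  rw [clientViewData, h1, h2]
  cases j <;> rfl

end Client

/-! ### Indistinguishability of a client's view -/

theorem card_allElements_le {m u : ℕ} (S : Inputs m u) :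
    (allElements S).card ≤ ∑ a : Bool × Fin m, (S a.1 a.2).card := card_biUnion_le

theorem Admissible.card_allElements {m : ℕ} {blockLen : ℕ → ℕ} {S : ∀ n, Inputs m (blockLen n)}
    (hS : Admissible S) : PolyBounded fun n => (allElements (S n)).card :=
  (PolyBounded.sum univ fun a : Bool × Fin m => hS.card_poly a.1 a.2).mono fun n =>
    card_allElements_le (S n)

/-- With the same keys in both experiments, real and simulated view are equal unless ciphertexts
collide. The distance is therefore statistical, and pseudorandomness enters only through
`point_bound`. -/
theorem indistinguishable_clientView {m : ℕ} {E : KeyedPerm} (hE : E.IsSecurePRP)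
    (hu : Negligible fun n => (1 / 2 : ℝ) ^ E.blockLen n) {PE : Prog}
    (hPE : ∀ n (k : BitVec n) (x : BitVec (E.blockLen n)),
      PE.output noOracle (Data.ofList [Data.ofNat n, Data.ofBits k, Data.ofBits x]) =
        PMF.pure (Data.ofBits (E.perm n k x)))
    (j : Bool) (i : Fin m) {S : ∀ n, Inputs m (E.blockLen n)} (hS : Admissible S) :
    Indistinguishable
      (fun n => (clientSim PE m j).output noOracle (clientSimInput E.blockLen n (S n) j i))
      (fun n => (egPSI1 m E).clientView n (S n) j i) := by
  classical
  intro D _ advice _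
  obtain ⟨δ, h1, h2, h3⟩ := hE.point_bound
  have hq0 : ∀ n, 0 ≤ (1 / 2 : ℝ) ^ E.blockLen n + δ n := fun n =>
    add_nonneg (by positivity) (h2 n)
  have hN : PolyBounded fun n => m ^ 4 * (allElements (S n)).card ^ 2 := by
    simp only [sq]
    exact (PolyBounded.const _).mul (hS.card_allElements.mul hS.card_allElements)
  refine ((hu.add h1).poly_mul hq0 hN).mono (fun n => abs_nonneg _) fun n => ?_
  refine le_trans ?_ (expect_collision_keys_le (E.perm n) (S n) (h3 n))
  set Φ : Data → ℝ := fun w =>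
    acceptProb (D.output noOracle (Data.ofList [Data.ofNat n, advice n, w])) with hΦ
  have e1 : acceptProb (((clientSim PE m j).output noOracle
      (clientSimInput E.blockLen n (S n) j i)).bind fun w =>
        D.output noOracle (Data.ofList [Data.ofNat n, advice n, w])) =
      𝔼 K : Fin m → Fin m → BitVec n,
        Φ (simView (E.perm n) (S n) j i fun l => sharedKey K j i l) := by
    -- The simulator's keys are read as one client's share of a full key matrix, so that both
    -- averages run over the same `K`.
    rw [clientSim_output (hPE n), ← uniform_bind_sharedKey j i, PMF.bind_bind,
      acceptProb_bind_uniform]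
    simp [hΦ]
  have e2 : acceptProb (((egPSI1 m E).clientView n (S n) j i).bind fun w =>
        D.output noOracle (Data.ofList [Data.ofNat n, advice n, w])) =
      𝔼 K : Fin m → Fin m → BitVec n, Φ (clientViewData (E.perm n) K (S n) j i) := by
    rw [egPSI1, PMF.bind_map, acceptProb_bind_uniform]
    rfl
  rw [e1, e2, ← expect_sub_distrib]
  refine (abs_expect_le _ _).trans (expect_le_expect fun K _ => ?_)
  split_ifs with h
  · rw [h.clientViewData_eq, sub_self, abs_zero]
  · rw [abs_le]
    constructor <;> linarith [acceptProb_nonneg (D.output noOracle (Data.ofList [Data.ofNat n,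
      advice n, clientViewData (E.perm n) K (S n) j i])), acceptProb_le_one (D.output noOracle
      (Data.ofList [Data.ofNat n, advice n, clientViewData (E.perm n) K (S n) j i])),
      acceptProb_nonneg (D.output noOracle (Data.ofList [Data.ofNat n, advice n,
        simView (E.perm n) (S n) j i fun l => sharedKey K j i l])),
      acceptProb_le_one (D.output noOracle (Data.ofList [Data.ofNat n, advice n,
        simView (E.perm n) (S n) j i fun l => sharedKey K j i l]))]

end GPSI

namespace GPSI

open Prog Function Finset
open scoped BigOperators

/-! ## The view of the third party as a function of the encryption functions -/

section View

variable {m u : ℕ}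

/-- The ciphertexts of a client, when `g i l` is the encryption function that the `i`-th client of
group 0 and the `l`-th client of group 1 share. -/
def funEncSet (g : Fin m → Fin m → BitVec u → BitVec u) (S : Inputs m u) (j : Bool) (i : Fin m) :
    Finset (BitVec u) :=
  univ.biUnion fun l => (S j i).image (bif j then g l i else g i l)

/-- The view of the third party for given encryption functions. -/
def funView (g : Fin m → Fin m → BitVec u → BitVec u) (S : Inputs m u) : Data :=
  ofGroups fun j i => Data.ofFinset (funEncSet g S j i)

theorem teeViewData_eq_funView {n : ℕ} (F : BitVec n → Equiv.Perm (BitVec u))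
    (K : Fin m → Fin m → BitVec n) (S : Inputs m u) :
    teeViewData F K S = funView (fun i l => F (K i l)) S := by
  rw [teeViewData, funView]
  congr 1
  funext j i
  cases j <;> rfl

/-- The view depends on finitely many values of each function. `switching` requires this locality.
-/
theorem funView_congr {g g' : Fin m → Fin m → BitVec u → BitVec u} {S : Inputs m u}
    (h : ∀ i l, ∀ e ∈ allElements S, g i l e = g' i l e) : funView g S = funView g' S := by
  rw [funView, funView]
  congr 1
  funext j i
  congr 1
  refine biUnion_congr rfl fun l _ => image_congr fun e he => ?_
  replace he := mem_allElements (mem_coe.1 he)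
  cases j
  exacts [h i l e he, h l i e he]

/-- The table of the lists of ciphertexts of all pairs of clients. -/
def tableData (X Y : Fin m → Fin m → List (BitVec u)) : Data :=
  Data.ofVec fun i => Data.ofVec fun l =>
    Data.node (Data.ofList ((X i l).map Data.ofBits)) (Data.ofList ((Y i l).map Data.ofBits))

end View

/-! ### Assembling the view from a table -/

/-- The concatenation of lists (each of them reversed). -/
def Prog.concatP : List Prog → Prog
  | [] => nil
  | p :: ps => revOnto p (concatP ps)

theorem Prog.PolyTime.concatP {ps : List Prog} (h : ∀ p ∈ ps, p.PolyTime) :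
    (concatP ps).PolyTime := by
  induction ps with
  | nil => exact .nil
  | cons p ps ih => exact .revOnto (h p (by simp)) (ih fun q hq => h q (by simp [hq]))

theorem Prog.det_concatP {ps : List Prog} (h : ∀ p ∈ ps, p.Det) : (concatP ps).Det := by
  induction ps with
  | nil => trivial
  | cons p ps ih => exact ⟨h p (by simp), ih fun q hq => h q (by simp [hq]), trivial, trivial⟩

theorem Prog.concatP_detVal {u k : ℕ} {P : Fin k → Prog} {env : List Data}
    {f : Fin k → List (BitVec u)}
    (h : ∀ i, (P i).detVal env = Data.ofList ((f i).map Data.ofBits)) :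
    ∃ L : List (BitVec u), (concatP (List.ofFn P)).detVal env = Data.ofList (L.map Data.ofBits) ∧
      L.toFinset = univ.biUnion fun i => (f i).toFinset := by
  induction k with
  | zero => exact ⟨[], rfl, by simp⟩
  | succ k ih =>
    obtain ⟨L, hL, hm⟩ := ih fun i => h i.succ
    refine ⟨(f 0).reverse ++ L, ?_, ?_⟩
    · rw [List.ofFn_succ, concatP, revOnto_detVal, h, hL]
      simp [Data.toList_ofList]
    · rw [List.toFinset_append, hm]
      ext c
      simp [Fin.exists_fin_succ]

/-- Computes the view of the third party from a table. -/
def assembleProg (m : ℕ) : Prog :=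
  pair
    (listP (List.ofFn fun i : Fin m => call sortProg
      (concatP (List.ofFn fun l : Fin m => fst (nthP l (nthP i (var 0)))))))
    (listP (List.ofFn fun l : Fin m => call sortProg
      (concatP (List.ofFn fun i : Fin m => snd (nthP l (nthP i (var 0)))))))

theorem assembleProg_det (m : ℕ) : (assembleProg m).Det := by
  refine ⟨det_listP ?_, det_listP ?_⟩ <;> intro p hp <;> obtain ⟨i, rfl⟩ := List.mem_ofFn.1 hp <;>
    refine ⟨sortProg_det, det_concatP fun q hq => ?_⟩ <;> obtain ⟨l, rfl⟩ := List.mem_ofFn.1 hq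
  · exact det_nthP (det_nthP (p := var 0) trivial i) l
  · exact det_nthP (det_nthP (p := var 0) trivial l) i

theorem assembleProg_polyTime (m : ℕ) : (assembleProg m).PolyTime := by
  refine .pair (.listP ?_) (.listP ?_) <;> intro p hp <;> obtain ⟨i, rfl⟩ := List.mem_ofFn.1 hp <;>
    refine .call sortProg_polyTime.on (.concatP fun q hq => ?_) <;>
    obtain ⟨l, rfl⟩ := List.mem_ofFn.1 hq
  · exact (((PolyTime.var 0).nthP i).nthP l).fst
  · exact (((PolyTime.var 0).nthP l).nthP i).snd

theorem assembleProg_detVal {m u : ℕ} (X Y : Fin m → Fin m → List (BitVec u)) :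
    (assembleProg m).detVal [tableData X Y] = ofGroups fun j i =>
      Data.ofFinset (univ.biUnion fun l => (bif j then Y l i else X i l).toFinset) := by
  have he : ∀ i l : Fin m, (nthP l (nthP i (var 0))).detVal [tableData X Y] =
      Data.node (Data.ofList ((X i l).map Data.ofBits)) (Data.ofList ((Y i l).map Data.ofBits)) := by
    intro i l
    have h1 : (nthP i (var 0)).detVal [tableData X Y] = Data.ofVec fun l =>
        Data.node (Data.ofList ((X i l).map Data.ofBits))
          (Data.ofList ((Y i l).map Data.ofBits)) :=
      detVal_nthP_ofVec (p := var 0) (v := fun i => Data.ofVec fun l =>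
        Data.node (Data.ofList ((X i l).map Data.ofBits))
          (Data.ofList ((Y i l).map Data.ofBits))) i rfl
    exact detVal_nthP_ofVec l h1
  rw [assembleProg, detVal, detVal_listP, detVal_listP, ofGroups, Data.ofVec, Data.ofVec,
    List.map_ofFn, List.map_ofFn]
  congr 3
  · funext i
    obtain ⟨L, hL, hm⟩ := concatP_detVal (env := [tableData X Y])
      (P := fun l : Fin m => fst (nthP l (nthP i (var 0)))) (f := fun l => X i l)
      fun l => by rw [detVal, he, Data.fst_node]
    simp only [comp_apply, detVal, hL, sortProg_ofList, hm, cond_false]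
  · funext l
    obtain ⟨L, hL, hm⟩ := concatP_detVal (env := [tableData X Y])
      (P := fun i : Fin m => snd (nthP l (nthP i (var 0)))) (f := fun i => Y i l)
      fun i => by rw [detVal, he, Data.snd_node]
    simp only [comp_apply, detVal, hL, sortProg_ofList, hm, cond_true]

/-- The table's lists matter only as sets, so the same program serves the simulator and the hybrid
adversaries, which list ciphertexts in different orders. -/
theorem assembleProg_funView {m u : ℕ} {X Y : Fin m → Fin m → List (BitVec u)}
    {g : Fin m → Fin m → BitVec u → BitVec u} {S : Inputs m u}
    (hX : ∀ i l, (X i l).toFinset = (S false i).image (g i l))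
    (hY : ∀ i l, (Y i l).toFinset = (S true l).image (g i l)) :
    (assembleProg m).detVal [tableData X Y] = funView g S := by
  rw [assembleProg_detVal, funView]
  congr 1
  funext j i
  congr 1
  refine biUnion_congr rfl fun l _ => ?_
  cases j
  exacts [hX i l, hY l i]

/-! ## The simulator of the third party -/

/-- The list `p` without as many entries as `q` has. -/
def Prog.minus (p q : Prog) : Prog := fold q p (snd (var 1))

theorem Prog.PolyTime.minus {p q : Prog} (hp : p.PolyTime) (hq : q.PolyTime) :
    (minus p q).PolyTime := .fold hq hp (PolyTime.var 1).snd (Grows.var).snd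

theorem length_foldl_snd (l : List Data) (a : Data) :
    (l.foldl (fun a _ => a.snd) a).toList.length = a.toList.length - l.length := by
  induction l generalizing a with
  | nil => rfl
  | cons x l ih =>
    rw [List.foldl_cons, ih, List.length_cons]
    cases a <;> simp [Data.toList]

theorem Prog.length_minus (p q : Prog) (env : List Data) :
    ((minus p q).detVal env).toList.length =
      (p.detVal env).toList.length - (q.detVal env).toList.length := by
  rw [← length_foldl_snd]
  rfl

/-- The size of an intersection, from the simulator's input (the `k`-th variable). -/
def cardP (k i l : ℕ) : Prog := nthP l (nthP i (fst (nthP 2 (var k))))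

/-- The two lists of ciphertexts of a pair of clients. -/
def entrySim (i l : ℕ) : Prog :=
  letIn (samples (cardP 0 i l) nil (snd (fst (var 2))))
    (pair
      (samples (minus (nthP i (fst (nthP 1 (var 1)))) (cardP 1 i l)) (var 0) (snd (fst (var 3))))
      (samples (minus (nthP l (snd (nthP 1 (var 1)))) (cardP 1 i l)) (var 0) (snd (fst (var 3)))))

/-- The simulator of the third party. -/
def thirdPartySim (m : ℕ) : Prog :=
  call (assembleProg m)
    (listP (List.ofFn fun i : Fin m => listP (List.ofFn fun l : Fin m => entrySim i l)))

theorem cardP_det (k i l : ℕ) : (cardP k i l).Det :=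
  det_nthP (p := nthP i (fst (nthP 2 (var k)))) (det_nthP (p := fst (nthP 2 (var k)))
    (det_nthP (p := var k) trivial 2) i) l

theorem cardP_polyTime (k i l : ℕ) : (cardP k i l).PolyTime :=
  ((((PolyTime.var k).nthP 2).fst).nthP i).nthP l

theorem sizeP_det (i : ℕ) :
    (nthP i (fst (nthP 1 (var 1)))).Det ∧ (nthP i (snd (nthP 1 (var 1)))).Det :=
  ⟨det_nthP (p := fst (nthP 1 (var 1))) (det_nthP (p := var 1) trivial 1) i,
    det_nthP (p := snd (nthP 1 (var 1))) (det_nthP (p := var 1) trivial 1) i⟩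

theorem entrySim_oracleFree (i l : ℕ) : (entrySim i l).OracleFree := by
  have h0 := (cardP_det 0 i l).oracleFree
  have h1 := (cardP_det 1 i l).oracleFree
  have h2 := (sizeP_det i).1.oracleFree
  have h3 := (sizeP_det l).2.oracleFree
  have h4 := randBits_oracleFree
  simp [entrySim, samples, minus, OracleFree, h0, h1, h2, h3, h4]

theorem entrySim_polyTime (i l : ℕ) : (entrySim i l).PolyTime := by
  have v := PolyTime.var
  refine .letIn (.samples (cardP_polyTime 0 i l) .nil (v 2).fst.snd
    (PolySizeOff.var (by decide)).fst.snd) (.pair ?_ ?_)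
  · exact .samples (.minus (((v 1).nthP 1).fst.nthP i) (cardP_polyTime 1 i l)) (v 0) (v 3).fst.snd
      (PolySizeOff.var (by decide)).fst.snd
  · exact .samples (.minus (((v 1).nthP 1).snd.nthP l) (cardP_polyTime 1 i l)) (v 0) (v 3).fst.snd
      (PolySizeOff.var (by decide)).fst.snd

theorem thirdPartySim_isPPT (m : ℕ) : (thirdPartySim m).IsPPT := by
  refine PolyTimeOn.isPPT (PolyTime.on (.call (assembleProg_polyTime m).on (.listP ?_)))
    ⟨(assembleProg_det m).oracleFree, oracleFree_listP ?_⟩ <;>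
    intro p hp <;> obtain ⟨i, rfl⟩ := List.mem_ofFn.1 hp
  · refine .listP fun q hq => ?_
    obtain ⟨l, rfl⟩ := List.mem_ofFn.1 hq
    exact entrySim_polyTime i l
  · refine oracleFree_listP fun q hq => ?_
    obtain ⟨l, rfl⟩ := List.mem_ofFn.1 hq
    exact entrySim_oracleFree i l

/-- The values of a uniform function on three disjoint lists are independent and uniform. -/
theorem uniform_bind_map_three {α β γ : Type*} [Fintype α] [DecidableEq α] [Fintype β] [Nonempty β]
    {L₁ L₂ L₃ : List α} (h₁ : L₁.Nodup) (h₂ : L₂.Nodup) (h₃ : L₃.Nodup)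
    (h₁₂ : ∀ x ∈ L₂, x ∉ L₁) (h₁₃ : ∀ x ∈ L₃, x ∉ L₁) (h₂₃ : ∀ x ∈ L₃, x ∉ L₂)
    {k₁ k₂ k₃ : ℕ} (e₁ : L₁.length = k₁) (e₂ : L₂.length = k₂) (e₃ : L₃.length = k₃)
    (Q : List β → List β → List β → PMF γ) :
    ((PMF.uniformOfFintype (α → β)).bind fun g => Q (L₁.map g) (L₂.map g) (L₃.map g)) =
      (PMF.uniformOfFintype (Fin k₁ → β)).bind fun a =>
        (PMF.uniformOfFintype (Fin k₂ → β)).bind fun b =>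
          (PMF.uniformOfFintype (Fin k₃ → β)).bind fun c =>
            Q (List.ofFn a) (List.ofFn b) (List.ofFn c) := by
  subst e₁ e₂ e₃
  rw [uniform_bind_map_list L₁ h₁ fun a g => Q a (L₂.map g) (L₃.map g)]
  · congr 1
    funext a
    rw [uniform_bind_map_list L₂ h₂ fun b g => Q (List.ofFn a) b (L₃.map g)]
    · congr 1
      funext b
      rw [uniform_bind_map_list L₃ h₃ fun c _ => Q (List.ofFn a) (List.ofFn b) c]
      · simp
      · exact fun _ _ _ _ => rfl
    · intro b g g' h
      rw [List.map_congr_left fun x hx => h x (h₂₃ x hx)]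
  · intro b g g' h
    rw [List.map_congr_left fun x hx => h x (h₁₂ x hx),
      List.map_congr_left fun x hx => h x (h₁₃ x hx)]

section ThirdPartySim

variable {m n : ℕ} {blockLen : ℕ → ℕ} (S : Inputs m (blockLen n))

/-- The ciphertexts of the elements of the `i`-th client of group 0 under a function that it shares
with the `l`-th client of group 1, in the order of the simulation. -/
noncomputable def simLeft (g : BitVec (blockLen n) → BitVec (blockLen n)) (i l : Fin m) :
    List (BitVec (blockLen n)) :=
  (((S false i) \ (S true l)).toList.map g).reverse ++
    (((S false i) ∩ (S true l)).toList.map g).reverse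

/-- The ciphertexts of the elements of the `l`-th client of group 1 under a function that it shares
with the `i`-th client of group 0, in the order of the simulation. -/
noncomputable def simRight (g : BitVec (blockLen n) → BitVec (blockLen n)) (i l : Fin m) :
    List (BitVec (blockLen n)) :=
  (((S true l) \ (S false i)).toList.map g).reverse ++
    (((S false i) ∩ (S true l)).toList.map g).reverse

theorem Data.length_ofNat (k : ℕ) : (Data.ofNat k).toList.length = k := by
  simp [Data.ofNat, Data.toList_ofList]

/-- A uniform function takes independent uniform values on the intersection and the two differences.
The values on the intersection are drawn once and end both lists; the private ones are put in front.
-/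
theorem entrySim_val (i l : Fin m) :
    (entrySim i l).val noOracle
        [thirdPartySimInput blockLen (fun _ S => pairwiseCard S) n S] =
      (PMF.uniformOfFintype (BitVec (blockLen n) → BitVec (blockLen n))).bind fun g =>
        PMF.pure (Data.node (Data.ofList ((simLeft S g i l).map Data.ofBits))
          (Data.ofList ((simRight S g i l).map Data.ofBits))) := by
  set d := thirdPartySimInput blockLen (fun _ S => pairwiseCard S) n S with hd
  have hcard : ∀ (k : ℕ) (env : List Data), env.getD k Data.nil = d →
      (cardP k i l).detVal env = Data.ofNat (pairwiseCard S false i l) := by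
    intro k env h
    have h1 : (fst (nthP 2 (var k))).detVal env = Data.ofVec fun i => Data.ofVec fun l =>
        Data.ofNat (pairwiseCard S false i l) := by
      change (((env.getD k Data.nil).snd.snd).fst).fst = _
      rw [h]
      rfl
    exact detVal_nthP_ofVec l (detVal_nthP_ofVec i h1)
  have hs0 : ∀ a : Data, (nthP i (fst (nthP 1 (var 1)))).detVal [a, d] =
      Data.ofNat (S false i).card := fun a =>
    detVal_nthP_ofVec (v := fun i => Data.ofNat (S false i).card) i rfl
  have hs1 : ∀ a : Data, (nthP l (snd (nthP 1 (var 1)))).detVal [a, d] =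
      Data.ofNat (S true l).card := fun a =>
    detVal_nthP_ofVec (v := fun i => Data.ofNat (S true i).card) l rfl
  have hu2 : ∀ x y : Data, ∃ z : Data, (snd (fst (var 2))).val noOracle (x :: y :: [d]) =
      PMF.pure z ∧ z.toList.length = blockLen n := fun x y =>
    ⟨_, Det.val_eq (P := snd (fst (var 2))) trivial _ _, Data.length_ofNat _⟩
  have hu3 : ∀ a x y : Data, ∃ z : Data, (snd (fst (var 3))).val noOracle (x :: y :: [a, d]) =
      PMF.pure z ∧ z.toList.length = blockLen n := fun a x y =>
    ⟨_, Det.val_eq (P := snd (fst (var 3))) trivial _ _, Data.length_ofNat _⟩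
  have hv0 : ∀ a : Data, (var 0).val noOracle [a, d] = PMF.pure a := fun a => val_var ..
  have hm0 : (minus (nthP i (fst (nthP 1 (var 1)))) (cardP 1 i l)).Det :=
    ⟨cardP_det 1 i l, (sizeP_det i).1, trivial⟩
  have hm1 : (minus (nthP l (snd (nthP 1 (var 1)))) (cardP 1 i l)).Det :=
    ⟨cardP_det 1 i l, (sizeP_det l).2, trivial⟩
  have k0 : ((cardP 0 i l).detVal [d]).toList.length = pairwiseCard S false i l := by
    rw [hcard 0 [d] rfl, Data.length_ofNat]
  have k2 : ∀ a : Data,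
      ((minus (nthP i (fst (nthP 1 (var 1)))) (cardP 1 i l)).detVal [a, d]).toList.length =
        (S false i).card - pairwiseCard S false i l := fun a => by
    rw [length_minus, hs0, hcard 1 [a, d] rfl, Data.length_ofNat, Data.length_ofNat]
  have k3 : ∀ a : Data,
      ((minus (nthP l (snd (nthP 1 (var 1)))) (cardP 1 i l)).detVal [a, d]).toList.length =
        (S true l).card - pairwiseCard S false i l := fun a => by
    rw [length_minus, hs1, hcard 1 [a, d] rfl, Data.length_ofNat, Data.length_ofNat]
  rw [entrySim, val_letIn, samples_val ((cardP_det 0 i l).val_eq _ _) k0 (val_nil ..) hu2,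
    PMF.bind_bind]
  simp only [PMF.pure_bind, val_pair,
    fun a => samples_val (hm0.val_eq noOracle [a, d]) (k2 a) (hv0 a) (hu3 a),
    fun a => samples_val (hm1.val_eq noOracle [a, d]) (k3 a) (hv0 a) (hu3 a), PMF.bind_bind]
  simp only [simLeft, simRight]
  -- The average over functions becomes three independent vectors in the order in which the
  -- simulator draws them: the intersection, then the two differences.
  rw [uniform_bind_map_three (L₁ := ((S false i) ∩ (S true l)).toList)
    (L₂ := ((S false i) \ (S true l)).toList) (L₃ := ((S true l) \ (S false i)).toList)
    (k₁ := pairwiseCard S false i l) (k₂ := (S false i).card - pairwiseCard S false i l)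
    (k₃ := (S true l).card - pairwiseCard S false i l) (nodup_toList _) (nodup_toList _)
    (nodup_toList _) (by simp only [mem_toList, mem_sdiff, mem_inter]; tauto)
    (by simp only [mem_toList, mem_sdiff, mem_inter]; tauto)
    (by simp only [mem_toList, mem_sdiff]; tauto) (length_toList _)
    (by rw [length_toList, card_sdiff, inter_comm]; rfl) (by rw [length_toList, card_sdiff]; rfl)
    fun A B C => PMF.pure (Data.node (Data.ofList ((B.reverse ++ A.reverse).map Data.ofBits))
      (Data.ofList ((C.reverse ++ A.reverse).map Data.ofBits)))]
  simp [Data.toList_ofList, Data.toList]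

/-- An exact equality of distributions: the simulator reproduces the TEE's view in the ideal
experiment in which every pair of clients shares an independent uniform function. -/
theorem thirdPartySim_output :
    (thirdPartySim m).output noOracle
        (thirdPartySimInput blockLen (fun _ S => pairwiseCard S) n S) =
      (PMF.uniformOfFintype (Fin m → Fin m → BitVec (blockLen n) → BitVec (blockLen n))).bind
        fun g => PMF.pure (funView g S) := by
  rw [output_eq_val, thirdPartySim, val_call,
    val_listP_uniform (A := Fin m → BitVec (blockLen n) → BitVec (blockLen n))
      (f := fun i g => Data.ofVec fun l =>
        Data.node (Data.ofList ((simLeft S (g l) i l).map Data.ofBits))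
          (Data.ofList ((simRight S (g l) i l).map Data.ofBits))) fun i =>
      val_listP_uniform (f := fun l g => 
        Data.node (Data.ofList ((simLeft S g i l).map Data.ofBits))
          (Data.ofList ((simRight S g i l).map Data.ofBits))) fun l => entrySim_val S i l,
    PMF.bind_bind]
  congr 1
  funext g
  rw [PMF.pure_bind, (assembleProg_det m).val_eq]
  congr 1
  refine assembleProg_funView (X := fun i l => simLeft S (g i l) i l)
    (Y := fun i l => simRight S (g i l) i l) (fun i l => ?_) fun i l => ?_
  · ext c
    simp only [simLeft, List.toFinset_append, List.toFinset_reverse, mem_union, List.mem_toFinset,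
      List.mem_map, mem_toList, mem_sdiff, mem_inter, mem_image]
    grind
  · ext c
    simp only [simRight, List.toFinset_append, List.toFinset_reverse, mem_union, List.mem_toFinset,
      List.mem_map, mem_toList, mem_sdiff, mem_inter, mem_image]
    grind

end ThirdPartySim

end GPSI

namespace GPSI

open Prog Function Finset
open scoped BigOperators

/-! ## The hybrid adversaries -/

/-- The list of the oracle's answers to the entries of a list, in reverse order. -/
def Prog.queryAll (p : Prog) : Prog := fold p nil (pair (query (var 0)) (var 1))

theorem Prog.PolyTime.queryAll {p : Prog} (hp : p.PolyTime) : (queryAll p).PolyTime :=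
  .fold hp .nil (.pair (.query (.var 0)) (.var 1)) (.pair .query .var)

/-- The table in the advice, with the entry `(i₀, l₀)` replaced by answers of the oracle. -/
def hybridTable (m : ℕ) (i₀ l₀ : Fin m) : Prog :=
  listP (List.ofFn fun i : Fin m => listP (List.ofFn fun l : Fin m =>
    if i = i₀ ∧ l = l₀ then
      pair (queryAll (nthP 2 (nthP 2 (var 0)))) (queryAll (nthP 3 (nthP 2 (var 0))))
    else nthP l (nthP i (nthP 1 (nthP 2 (var 0))))))

/-- The adversary that runs the distinguisher `D` on the view computed from the table. -/
def hybridProg (D : Prog) (m : ℕ) (i₀ l₀ : Fin m) : Prog :=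
  call D (listP [nthP 0 (var 0), nthP 0 (nthP 2 (var 0)),
    call (assembleProg m) (hybridTable m i₀ l₀)])

theorem hybridProg_polyTime {D : Prog} (hD : D.IsPPT) (m : ℕ) (i₀ l₀ : Fin m) :
    (hybridProg D m i₀ l₀).PolyTime := by
  have v := PolyTime.var 0
  refine .call hD.polyTimeOn (.listP ?_)
  simp only [List.mem_cons, List.not_mem_nil, or_false, forall_eq_or_imp, forall_eq]
  refine ⟨v.nthP 0, (v.nthP 2).nthP 0, .call (assembleProg_polyTime m).on (.listP ?_)⟩
  intro p hp
  obtain ⟨i, rfl⟩ := List.mem_ofFn.1 hp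
  refine .listP fun q hq => ?_
  obtain ⟨l, rfl⟩ := List.mem_ofFn.1 hq
  split_ifs
  · exact .pair (.queryAll ((v.nthP 2).nthP 2)) (.queryAll ((v.nthP 2).nthP 3))
  · exact (((v.nthP 2).nthP 1).nthP i).nthP l

section Hybrid

variable {m u : ℕ}

/-- The table for given encryption functions. -/
def funTable (g : Fin m → Fin m → BitVec u → BitVec u) (S : Inputs m u) : Data :=
  tableData (fun i l => (((S false i).sort (· ≤ ·)).map (g i l)).reverse)
    (fun i l => (((S true l).sort (· ≤ ·)).map (g i l)).reverse)

theorem assembleProg_funTable (g : Fin m → Fin m → BitVec u → BitVec u) (S : Inputs m u) :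
    (assembleProg m).detVal [funTable g S] = funView g S := by
  refine assembleProg_funView (fun i l => ?_) fun i l => ?_ <;> ext c <;> simp

/-- The advice of the hybrid adversary. -/
def hybridAdvice (a : Data) (S : Inputs m u) (i₀ l₀ : Fin m)
    (g : Fin m → Fin m → BitVec u → BitVec u) : Data :=
  Data.ofList [a, funTable g S, Data.ofFinset (S false i₀), Data.ofFinset (S true l₀)]

theorem queryAll_val {p : Prog} {env : List Data} {s : Finset (BitVec u)}
    (π : Equiv.Perm (BitVec u)) (h : p.val (permOracle π) env = PMF.pure (Data.ofFinset s)) :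
    (queryAll p).val (permOracle π) env =
      PMF.pure (Data.ofList ((((s.sort (· ≤ ·)).map π).reverse).map Data.ofBits)) := by
  rw [queryAll, val_fold, h, val_nil, PMF.pure_bind, PMF.pure_bind, Data.ofFinset,
    Data.toList_ofList, foldVal_map_pure (h := fun e => Data.ofBits (π e))]
  · simp [Data.toList, Function.comp_def]
  · intro e _ y
    rw [val_pair, val_query, val_var, val_var]
    simp [permOracle_ofBits]

theorem hybridTable_val (π : Equiv.Perm (BitVec u)) (a b c : Data) (S : Inputs m u)
    (i₀ l₀ : Fin m) (g : Fin m → Fin m → BitVec u → BitVec u) :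
    (hybridTable m i₀ l₀).val (permOracle π) [Data.ofList [b, c, hybridAdvice a S i₀ l₀ g]] =
      PMF.pure (funTable (update g i₀ (update (g i₀) l₀ π)) S) := by
  have hd : ∀ k, (nthP k (nthP 2 (var 0))).Det := fun k =>
    det_nthP (p := nthP 2 (var 0)) (det_nthP (p := var 0) trivial 2) k
  refine val_listP_pure fun i => val_listP_pure fun l => ?_
  split_ifs with h
  · obtain ⟨rfl, rfl⟩ := h
    rw [val_pair, queryAll_val (s := S false i) π ((hd 2).val_eq _ _),
      queryAll_val (s := S true l) π ((hd 3).val_eq _ _)]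
    simp
  · have h1 : (nthP l (nthP i (nthP 1 (nthP 2 (var 0))))).detVal
        [Data.ofList [b, c, hybridAdvice a S i₀ l₀ g]] =
          Data.node (Data.ofList ((((S false i).sort (· ≤ ·)).map (g i l)).reverse.map Data.ofBits))
            (Data.ofList ((((S true l).sort (· ≤ ·)).map (g i l)).reverse.map Data.ofBits)) :=
      detVal_nthP_ofVec (v := fun l => Data.node
          (Data.ofList ((((S false i).sort (· ≤ ·)).map (g i l)).reverse.map Data.ofBits))
          (Data.ofList ((((S true l).sort (· ≤ ·)).map (g i l)).reverse.map Data.ofBits))) l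
        (detVal_nthP_ofVec (v := fun i => Data.ofVec fun l => Data.node
          (Data.ofList ((((S false i).sort (· ≤ ·)).map (g i l)).reverse.map Data.ofBits))
          (Data.ofList ((((S true l).sort (· ≤ ·)).map (g i l)).reverse.map Data.ofBits))) i rfl)
    have h2 : update g i₀ (update (g i₀) l₀ π) i l = g i l := by
      by_cases hi : i = i₀
      · subst hi
        rw [update_self, update_of_ne fun hl => h ⟨rfl, hl⟩]
      · rw [update_of_ne hi]
    rw [Det.val_eq (det_nthP (det_nthP (hd 1) i) l), h1]
    simp only [h2]

/-- This turns a change of the oracle into a change of one entry of the hybrid. The advice supplies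
all other entries and the advice of `D`. -/
theorem hybridProg_output {D : Prog} (hD : D.IsPPT) (π : Equiv.Perm (BitVec u)) (a b c : Data)
    (S : Inputs m u) (i₀ l₀ : Fin m) (g : Fin m → Fin m → BitVec u → BitVec u) :
    (hybridProg D m i₀ l₀).output (permOracle π)
        (Data.ofList [b, c, hybridAdvice a S i₀ l₀ g]) =
      D.output noOracle
        (Data.ofList [b, a, funView (update g i₀ (update (g i₀) l₀ π)) S]) := by
  have h0 : (nthP 0 (var 0)).Det := det_nthP (p := var 0) trivial 0
  have h1 : (nthP 0 (nthP 2 (var 0))).Det :=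
    det_nthP (p := nthP 2 (var 0)) (det_nthP (p := var 0) trivial 2) 0
  rw [output_eq_val, hybridProg, val_call, listP, val_pair, h0.val_eq, listP, val_pair, h1.val_eq,
    listP, val_pair, val_call, hybridTable_val, listP, val_nil]
  simp only [PMF.pure_bind, (assembleProg_det m).val_eq, assembleProg_funTable]
  -- `D` asks no queries, so the permutation oracle can be withdrawn from it.
  rw [hD.1.val_eq _ noOracle]
  rfl

theorem size_ofVec_le {v : Fin m → Data} {c : ℕ} (h : ∀ i, (v i).size ≤ c) :
    (Data.ofVec v).size ≤ m * (c + 1) + 1 := by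
  have := Data.size_ofList_le (l := List.ofFn v) (c := c) (by
    intro d hd
    obtain ⟨i, rfl⟩ := List.mem_ofFn.1 hd
    exact h i)
  simpa [Data.ofVec] using this

/-- The bound does not involve `g`, so a worst `g` can be hardwired into advice of polynomial size.
-/
theorem size_hybridAdvice_le (a : Data) (S : Inputs m u) (i₀ l₀ : Fin m)
    (g : Fin m → Fin m → BitVec u → BitVec u) :
    (hybridAdvice a S i₀ l₀ g).size ≤
      a.size + (m * (m * ((allElements S).card * (u * 8 + 4) + 4) + 2) + 1) +
        (allElements S).card * (u * 8 + 4) + 10 := by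
  set N := (allElements S).card with hN
  have hc : ∀ j i, (S j i).card ≤ N := fun j i => card_le_card fun e he => mem_allElements he
  have hl : ∀ (j : Bool) (i : Fin m) (l : List (BitVec u)), l.length = (S j i).card →
      (Data.ofList (l.map Data.ofBits)).size ≤ N * (u * 4 + 2) + 1 := fun j i l h =>
    (Data.size_map_ofBits_le l).trans (by rw [h]; gcongr; exact hc j i)
  have ht : (funTable g S).size ≤ m * (m * (N * (u * 8 + 4) + 4) + 2) + 1 := by
    refine (size_ofVec_le (c := m * (N * (u * 8 + 4) + 4) + 1) fun i =>
      size_ofVec_le (c := N * (u * 8 + 4) + 3) fun l => ?_)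
    have h1 := hl false i (((S false i).sort (· ≤ ·)).map (g i l)).reverse (by simp)
    have h2 := hl true l (((S true l).sort (· ≤ ·)).map (g i l)).reverse (by simp)
    rw [Data.size]
    linarith
  have h1 := hl false i₀ _ ((S false i₀).length_sort (· ≤ ·))
  have h2 := hl true l₀ _ ((S true l₀).length_sort (· ≤ ·))
  simp only [hybridAdvice, Data.ofList, Data.size, Data.ofFinset] at *
  linarith

end Hybrid

/-- Each of the `m * m` replacements passes from a PRP under a random key to a uniform permutation
and then to a uniform function. As `m` is constant, the total error is negligible. -/
theorem indistinguishable_thirdPartyView {m : ℕ} {E : KeyedPerm} (hE : E.IsSecurePRP)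
    (hu : Negligible fun n => (1 / 2 : ℝ) ^ E.blockLen n)
    {S : ∀ n, Inputs m (E.blockLen n)} (hS : Admissible S) :
    Indistinguishable
      (fun n => (thirdPartySim m).output noOracle
        (thirdPartySimInput E.blockLen (fun _ S => pairwiseCard S) n (S n)))
      (fun n => (egPSI1 m E).thirdPartyView n (S n)) := by
  intro D hD advice hadvice
  have hN := hS.card_allElements
  set N : ℕ → ℕ := fun n => (allElements (S n)).card with hNdef
  have c := PolyBounded.const
  have hNu : PolyBounded fun n => N n * (E.blockLen n * 8 + 4) :=
    hN.mul ((hE.blockLen_poly.mul (c 8)).add (c 4))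
  have hbound : PolyBounded fun n => (advice n).size +
      (m * (m * (N n * (E.blockLen n * 8 + 4) + 4) + 2) + 1) +
        N n * (E.blockLen n * 8 + 4) + 10 :=
    ((hadvice.add (((c m).mul (((c m).mul (hNu.add (c 4))).add (c 2))).add (c 1))).add hNu).add
      (c 10)
  -- There is one adversary for each entry of the matrix. The index `g` runs over a huge but finite
  -- set, which suffices for a worst case to exist.
  choose δ h1 h2 h3 using fun p : Fin m × Fin m =>
    hE.uniform_advantage (hybridProg_polyTime hD m p.1 p.2)
      (ι := fun n => Fin m → Fin m → BitVec (E.blockLen n) → BitVec (E.blockLen n))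
      (fun n g => hybridAdvice (advice n) (S n) p.1 p.2 g) hbound
      fun n g => size_hybridAdvice_le _ _ _ _ _
  have hsq : PolyBounded fun n => N n ^ 2 := by
    simp only [sq]
    exact hN.mul hN
  have hneg := (((Negligible.sum univ h1).add
    (hu.poly_mul (fun n => by positivity) hsq)).const_mul (m : ℝ)).const_mul (m : ℝ)
  refine hneg.mono (fun n => abs_nonneg _) fun n => ?_
  set Φ : (Fin m → Fin m → BitVec (E.blockLen n) → BitVec (E.blockLen n)) → ℝ := fun g =>
    acceptProb (D.output noOracle (Data.ofList [Data.ofNat n, advice n, funView g (S n)])) with hΦ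
  have e1 : acceptProb (((thirdPartySim m).output noOracle
      (thirdPartySimInput E.blockLen (fun _ S => pairwiseCard S) n (S n))).bind fun w =>
        D.output noOracle (Data.ofList [Data.ofNat n, advice n, w])) =
      𝔼 g : Fin m → Fin m → BitVec (E.blockLen n) → BitVec (E.blockLen n), Φ g := by
    rw [thirdPartySim_output, PMF.bind_bind, acceptProb_bind_uniform]
    simp [hΦ]
  have e2 : acceptProb (((egPSI1 m E).thirdPartyView n (S n)).bind fun w =>
        D.output noOracle (Data.ofList [Data.ofNat n, advice n, w])) =
      𝔼 K : Fin m → Fin m → BitVec n, Φ fun i l => E.perm n (K i l) := by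
    rw [egPSI1, PMF.bind_map, acceptProb_bind_uniform]
    simp only [comp_apply, teeViewData_eq_funView, hΦ]
  rw [e1, e2, abs_sub_comm]
  refine hybrid_bound_matrix (fun k : BitVec n => ⇑(E.perm n k)) id _ m m Φ fun i l g => ?_
  have hA := h3 (i, l) n g
  simp only [hybridProg_output hD] at hA
  -- Only the entry `(i, l)` varies, and only its values on `allElements (S n)` reach the view.
  have hB := (switching (allElements (S n))
    (fun f => Φ (update g i (update (g i) l f))) (fun f => acceptProb_nonneg _)
    (fun f => acceptProb_le_one _) fun f f' h => by
      simp only [hΦ]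
      rw [funView_congr fun i' l' e he => ?_]
      by_cases hi : i' = i
      · subst hi
        by_cases hl : l' = l
        · subst hl
          simpa using h e he
        · simp [update_of_ne hl]
      · simp [update_of_ne hi]).trans (expect_collision_le (allElements (S n)))
  have hcard : ((allElements (S n)).card : ℝ) ^ 2 / Fintype.card (BitVec (E.blockLen n)) =
      (N n ^ 2 : ℕ) * (1 / 2 : ℝ) ^ E.blockLen n := by
    rw [Fintype.card_congr (BitVec.equivFin (m := E.blockLen n)).toEquiv]
    simp [hNdef, div_eq_mul_inv]
  rw [hcard] at hB
  have hsum : δ (i, l) n ≤ ∑ p, δ p n :=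
    single_le_sum (f := fun p => δ p n) (fun p _ => h2 p n) (mem_univ (i, l))
  refine (abs_sub_le _ (𝔼 π : Equiv.Perm (BitVec (E.blockLen n)),
    Φ (update g i (update (g i) l π))) _).trans (add_le_add (hA.trans hsum) ?_)
  exact hB

end GPSI

theorem theorem1 (m : ℕ) (E : GPSI.KeyedPerm) (hE : E.IsSecurePRP)
    (hu : GPSI.Negligible fun n => (1 / 2 : ℝ) ^ E.blockLen n) :
    GPSI.SecurelyRealizes (GPSI.egPSI1 m E) (fun _ S => GPSI.pairwiseCard S) := by
  obtain ⟨PE, hPE, hval⟩ := hE.computable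
  exact ⟨fun j i => ⟨GPSI.clientSim PE m j, GPSI.clientSim_isPPT hPE m j,
      fun S hS => GPSI.indistinguishable_clientView hE hu hval j i hS⟩,
    GPSI.thirdPartySim m, GPSI.thirdPartySim_isPPT m,
    fun S hS => GPSI.indistinguishable_thirdPartyView hE hu hS⟩
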